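/- **Setting.** Let $N\ge 1$. Nodes $0,\dots,N$ are agents; node $0$ is the leader, nodes $1,\dots,N$ are the followers. Two directed graphs without self-loops are given on these nodes, a coupling graph $\mathcal E^\varphi$ and a communication graph $\mathcal E^c$; an edge $(j,i)$ goes from $j$ to $i$. In $\mathcal E^c$ no edge ends at $0$. For a follower $i$ put $S^\varphi_i=\{j\ge 1:(j,i)\in\mathcal E^\varphi\}$, $S^c_i=\{j\ge1:(j,i)\in\mathcal E^c\}$; $d_i=1$ if $(0,i)\in\mathcal E^\varphi$ and $d_i=0$ otherwise; $\bar d_i=1$ if $(i,0)\in\mathcal E^\varphi$ and $\bar d_i=0$ otherwise; $g_i=1$ if $(0,i)\in\mathcal E^c$ and $g_i=0$ otherwise. Let $L$ be the Laplacian (in-degree matrix minus adjacency matrix) of the communication graph restricted to the followers, $G=\mathrm{diag}(g_i)$, $\vartheta=(L+G)^{-1}\mathbf 1$, $\Theta=\mathrm{diag}(\vartheta)$, $\sigma=\frac12\lambda_{\min}\big(\Theta^{-1}(L+G)+(L+G)'\Theta^{-1}\big)$ and $\hat\lambda=\lambda_{\max}\big((L+G)'\Theta^{-2}(L+G)\big)$.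 Assume that the communication graph restricted to the followers contains a directed spanning tree whose root $i_r$ is pinned ($g_{i_r}=1$), and that $\Theta^{-1}(L+G)+(L+G)'\Theta^{-1}$ is positive definite (i.e. $\sigma>0$). Let $\Gamma=[a,b]$ be a compact interval, $A:\Gamma\to\mathbb R^{n\times n}$ continuous, $B_1\in\mathbb R^{n\times p}$, $B_2\in\mathbb R^{n\times m}$, and $C_{ij}$ real matrices with $n$ columns. Let $\rho:[0,\infty)\to\Gamma$ be differentiable. The agents obey $$\dot x_i=A(\rho(t))x_i+B_1u_i+B_2\sum_{j:(j,i)\in\mathcal E^\varphi}\Delta_{ij}(t)C_{ij}(x_j-x_i),\qquad i=0,\dots,N,\quad u_0\equiv0,$$ where the uncertain $\Delta_{ij}$ satisfy $\Delta_{ij}(t)'\Delta_{ij}(t)\le I$ for all $t\ge0$; $\Xi$ is the class of all such uncertainties. Trajectories are locally absolutely continuous and satisfy the equations almost everywhere. Let $Q=Q'>0$, $R=R'>0$, $\bar Q=(\sigma^2/\hat\lambda)Q$ and $$\mathcal J(u)=\sum_{i=1}^N\int_0^\infty\big((x_0-x_i)'Q(x_0-x_i)+u_i'Ru_i\big)\,dt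 .$$ **LMIs.** For $\rho\in\Gamma$, $\beta>0$, a symmetric $Y>0$ and positive constants $\pi_i$, $\nu_{ij},\mu_{ij}$ ($j\in S_i^\varphi$), $\nu_{i0}$ (if $d_i=1$), $\mu_{0i}$ (if $\bar d_i=1$), let $W_i=[\,\bar Q^{1/2},\ \hat C_i',\ \bar C_i',\ I,\ C_{i0}',\ C_{0i}'\,]$, where $\hat C_i$ stacks $C_{ij}$, $j\in S^\varphi_i$, $\bar C_i$ stacks $C_{ji}$ over the $j$ with $i\in S^\varphi_j$, and the block $C_{i0}'$ (resp. $C_{0i}'$) is present only if $d_i=1$ (resp. $\bar d_i=1$). Let $D_i$ be the block-diagonal matrix with corresponding blocks $I$; $\nu_{ij}^{-1}I$ ($j\in S^\varphi_i$); $\mu_{ji}^{-1}I$ ($j$ with $i\in S^\varphi_j$); $\pi_i^{-1}I$; $\nu_{i0}^{-1}I$; $(N\mu_{0i})^{-1}I$, and $$\Pi_i=\begin{bmatrix}Z_i&YW_i\\W_i'Y&-D_i\end{bmatrix},$$ $$Z_i=A(\rho)Y+YA(\rho)'-B_1R^{-1}B_1'+\tfrac{\beta^2}{\pi_i}I+\Big(\sum_{j\in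 S^\varphi_i}\big(\tfrac1{\nu_{ij}}+\tfrac1{\mu_{ij}}\big)+\tfrac{d_i}{\nu_{i0}}+\sum_{k:\bar d_k=1}\tfrac1{\mu_{0k}}\Big)B_2B_2',$$ where the term $d_i/\nu_{i0}$ is absent if $d_i=0$. The LMIs are feasible at $\rho$ with constant $\beta$ if such $Y$ and constants exist with $\Pi_i<0$ for all $i=1,\dots,N$. **Design.** Let $\rho_0<\dots<\rho_M$ be design points in $\Gamma$ and $\beta_s>0$ constants such that the LMIs are feasible at $\rho_s$ with constant $\beta_s$ for every $s$; fix a feasible solution for each $s$, with matrix $Y_{\rho_s}$. Let $\rho_s<\underline\rho_{s+1}<\bar\rho_s<\rho_{s+1}$ for $0\le s<M$, and suppose that $(A(\rho)-A(\rho_s))'(A(\rho)-A(\rho_s))\le\beta_s^2I$ for all $\rho\in[\rho_s,\bar\rho_s)$ and that $(A(\rho)-A(\rho_{s+1}))'(A(\rho)-A(\rho_{s+1}))\le\beta_{s+1}^2I$ for all $\rho\in[\underline\rho_{s+1},\rho_{s+1})$ ($0\le s<M$); if $a<\rho_0$ or $\rho_M<b$, the same bound with $\rho_0,\beta_0$ (resp.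 $\rho_M,\beta_M$) is supposed on $[a,\rho_0]$ (resp. $[\rho_M,b]$). For $\rho\in[\rho_s,\rho_{s+1}]$ set $Y_\rho=\gamma Y_{\rho_s}+(1-\gamma)Y_{\rho_{s+1}}$, where $\gamma=1$ for $\rho<\underline\rho_{s+1}$, $\gamma=(\bar\rho_s-\rho)/(\bar\rho_s-\underline\rho_{s+1})$ for $\rho\in[\underline\rho_{s+1},\bar\rho_s]$ and $\gamma=0$ for $\rho>\bar\rho_s$; $Y_\rho=Y_{\rho_0}$ for $\rho\le\rho_0$ and $Y_\rho=Y_{\rho_M}$ for $\rho\ge\rho_M$. Let $\Gamma_0$ be the set of all points $\underline\rho_{s+1},\bar\rho_s$, and $$K_i(\rho)=-(\vartheta_i\sigma)^{-1}R^{-1}B_1'Y_\rho^{-1},\quad \eta=\min_{\rho\in\Gamma}\lambda_{\min}\big(Y_\rho^{-1}B_1R^{-1}B_1'Y_\rho^{-1}+\bar Q\big),\quad \varrho=\sup_{\rho\in\Gamma\setminus\Gamma_0}\Big\|\frac{dY_\rho^{-1}}{d\rho}\Big\|$$ (spectral norm). **Theorem.** Suppose $\varrho\,|\dot\rho(t)|\le\eta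 q$ for all $t\ge0$ with a constant $q\in[0,1)$ (that is, $\sup_t|\dot\rho(t)|\le\frac{\eta}{\varrho}q$ if $\varrho>0$). Then the gains $K_i$ are continuous on $\Gamma$, and the protocol $$u_i=-K_i(\rho(t))\Big\{\sum_{j\in S^c_i}(x_j-x_i)+g_i(x_0-x_i)\Big\},\qquad i=1,\dots,N,$$ solves the leader-follower tracking problem: for all initial states, $\sup_\Xi\mathcal J(u)$ is bounded by a finite constant that may depend on the initial states. Moreover, for all initial states, $$\sup_\Xi\mathcal J(u)\le\frac{\hat\lambda}{(1-q)\sigma^2}\sum_{i=1}^N(x_0(0)-x_i(0))'Y_{\rho(0)}^{-1}(x_0(0)-x_i(0)).$$ -/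

import Mathlib

open Matrix MeasureTheory Set

noncomputable section

namespace LeaderFollower

/-! ### Directed graphs on the node set `{0, …, N}`

Node `0` is the leader; the followers are `i.succ` for `i : Fin N`.
`G.Adj j i` means that `(j, i)` is an edge: it originates at `j` and ends at `i`, so that `i` obtains
information from (or is influenced by) `j`. -/

/-- `T` is a directed tree rooted at `r` that spans the whole vertex set: the root has no parent,
every other vertex has exactly one parent, and every vertex is reached from the root. -/
def IsSpanningTreeFrom {V : Type*} (T : Digraph V) (r : V) : Prop :=
  (∀ v, ¬ T.Adj v r) ∧ (∀ v, v ≠ r → ∃! u, T.Adj u v) ∧ ∀ v, Relation.ReflTransGen T.Adj r v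

section Graph

variable {N : ℕ}

/-- The subgraph on the followers. -/
def followerGraph (G : Digraph (Fin (N + 1))) : Digraph (Fin N) where
  Adj j i := G.Adj j.succ i.succ

/-- The follower subgraph contains a spanning tree whose root is pinned. -/
def HasPinnedSpanningTree (G : Digraph (Fin (N + 1))) : Prop :=
  ∃ (T : Digraph (Fin N)) (r : Fin N),
    (∀ j i, T.Adj j i → (followerGraph G).Adj j i) ∧ IsSpanningTreeFrom T r ∧ G.Adj 0 r.succ

open Classical in
/-- Adjacency matrix of the follower subgraph: the `(i, j)` entry is `1` iff `(j, i)` is an edge. -/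
def adjacency (G : Digraph (Fin (N + 1))) : Matrix (Fin N) (Fin N) ℝ :=
  Matrix.of fun i j => if (followerGraph G).Adj j i then 1 else 0

open Classical in
/-- Pinning gains: `1` iff the follower receives information from the leader. -/
def pin (G : Digraph (Fin (N + 1))) (i : Fin N) : ℝ := if G.Adj 0 i.succ then 1 else 0

/-- Laplacian of the follower subgraph: in-degree matrix minus adjacency matrix. -/
def laplacian (G : Digraph (Fin (N + 1))) : Matrix (Fin N) (Fin N) ℝ :=
  Matrix.diagonal (fun i => ∑ j, adjacency G i j) - adjacency G

/-- Laplacian plus pinning matrix. -/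
def pinnedLaplacian (G : Digraph (Fin (N + 1))) : Matrix (Fin N) (Fin N) ℝ :=
  laplacian G + Matrix.diagonal (pin G)

/-- The vector `ϑ = (L + G)⁻¹ 1`. -/
def theta (G : Digraph (Fin (N + 1))) : Fin N → ℝ := (pinnedLaplacian G)⁻¹ *ᵥ fun _ => 1

/-- `Θ = diag ϑ`. -/
def Theta (G : Digraph (Fin (N + 1))) : Matrix (Fin N) (Fin N) ℝ := Matrix.diagonal (theta G)

/-- `Θ⁻¹ (L + G) + (L + G)' Θ⁻¹`. -/
def symTheta (G : Digraph (Fin (N + 1))) : Matrix (Fin N) (Fin N) ℝ :=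
  (Theta G)⁻¹ * pinnedLaplacian G + (pinnedLaplacian G)ᵀ * (Theta G)⁻¹

/-- Smallest eigenvalue of a real symmetric matrix. -/
def lambdaMin {k : ℕ} (M : Matrix (Fin k) (Fin k) ℝ) : ℝ := sInf (spectrum ℝ M)

/-- Largest eigenvalue of a real symmetric matrix. -/
def lambdaMax {k : ℕ} (M : Matrix (Fin k) (Fin k) ℝ) : ℝ := sSup (spectrum ℝ M)

/-- The constant `σ`. -/
def sigma (G : Digraph (Fin (N + 1))) : ℝ := (1 / 2) * lambdaMin (symTheta G)

/-- The constant `λ̂`. -/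
def lambdaHat (G : Digraph (Fin (N + 1))) : ℝ :=
  lambdaMax ((pinnedLaplacian G)ᵀ * ((Theta G)⁻¹ * (Theta G)⁻¹) * pinnedLaplacian G)

end Graph

/-! ### The interconnected system -/

/-- Data of the parameter-varying interconnected system: states in `ℝⁿ`, controls in `ℝᵖ`,
interaction signals in `ℝᵐ`. -/
structure MultiAgentSystem (N n p m : ℕ) where
  /-- coupling (interconnection) graph -/
  coupling : Digraph (Fin (N + 1))
  /-- communication graph -/
  comm : Digraph (Fin (N + 1))
  coupling_loopless : ∀ i, ¬ coupling.Adj i i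
  comm_loopless : ∀ i, ¬ comm.Adj i i
  /-- the leader receives no information -/
  comm_leader : ∀ j, ¬ comm.Adj j 0
  A : ℝ → Matrix (Fin n) (Fin n) ℝ
  B₁ : Matrix (Fin n) (Fin p) ℝ
  B₂ : Matrix (Fin n) (Fin m) ℝ
  /-- number of rows of `C i j` -/
  rows : Fin (N + 1) → Fin (N + 1) → ℕ
  /-- output matrices of the interactions; `C i j` is used only when `(j, i)` is a coupling edge -/
  C : ∀ i j, Matrix (Fin (rows i j)) (Fin n) ℝ

variable {N n p m : ℕ}

namespace MultiAgentSystem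

variable (S : MultiAgentSystem N n p m)

/-- Time-varying interaction coefficients `Δ i j t`. -/
abbrev Uncertainty : Type :=
  ∀ i j : Fin (N + 1), ℝ → Matrix (Fin m) (Fin (S.rows i j)) ℝ

/-- The class `Ξ`: norm-bounded interactions, `Δ' Δ ≤ I` for all `t ≥ 0`. -/
def NormBounded (Δ : S.Uncertainty) : Prop :=
  ∀ i j, S.coupling.Adj j i → ∀ t, 0 ≤ t → (1 - (Δ i j t)ᵀ * Δ i j t).PosSemidef

open Classical in
/-- The protocol: `u_i = -K_i(ρ) (∑_{j ∈ S_i} (x_j - x_i) + g_i (x_0 - x_i))` for follower `i`,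
with parameter value `r` and agent states `x`. -/
def control (K : Fin N → ℝ → Matrix (Fin p) (Fin n) ℝ) (r : ℝ) (x : Fin (N + 1) → Fin n → ℝ)
    (i : Fin N) : Fin p → ℝ :=
  -(K i r *ᵥ ((∑ j : Fin N, if S.comm.Adj j.succ i.succ then x j.succ - x i.succ else 0)
      + pin S.comm i • (x 0 - x i.succ)))

/-- Controls of all agents; the leader is not controlled. -/
def allControls (K : Fin N → ℝ → Matrix (Fin p) (Fin n) ℝ) (r : ℝ) (x : Fin (N + 1) → Fin n → ℝ) :
    Fin (N + 1) → Fin p → ℝ :=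
  Fin.cons 0 (S.control K r x)

open Classical in
/-- Right-hand side of the closed-loop dynamics of agent `i`. -/
def closedLoopField (K : Fin N → ℝ → Matrix (Fin p) (Fin n) ℝ) (ρ : ℝ → ℝ) (Δ : S.Uncertainty)
    (t : ℝ) (x : Fin (N + 1) → Fin n → ℝ) (i : Fin (N + 1)) : Fin n → ℝ :=
  S.A (ρ t) *ᵥ x i + S.B₁ *ᵥ S.allControls K (ρ t) x i
    + S.B₂ *ᵥ ∑ j, if S.coupling.Adj j i then Δ i j t *ᵥ (S.C i j *ᵥ (x j - x i)) else 0

/-- `x` is a trajectory of the closed-loop system on `[0, ∞)` with initial states `x₀`: it is locally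
absolutely continuous and satisfies the differential equations almost everywhere. -/
structure IsTrajectory (K : Fin N → ℝ → Matrix (Fin p) (Fin n) ℝ) (ρ : ℝ → ℝ) (Δ : S.Uncertainty)
    (x₀ : Fin (N + 1) → Fin n → ℝ) (x : ℝ → Fin (N + 1) → Fin n → ℝ) : Prop where
  initial : x 0 = x₀
  absCont : ∀ i, ∀ T, 0 ≤ T → AbsolutelyContinuousOnInterval (fun t => x t i) 0 T
  dynamics : ∀ i, ∀ᵐ t, 0 < t →
    HasDerivAt (fun s => x s i) (S.closedLoopField K ρ Δ t (x t) i) t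

/-- The tracking performance index `J(u)` along a closed-loop trajectory, a value in `[0, ∞]`. -/
def cost (Q : Matrix (Fin n) (Fin n) ℝ) (R : Matrix (Fin p) (Fin p) ℝ)
    (K : Fin N → ℝ → Matrix (Fin p) (Fin n) ℝ) (ρ : ℝ → ℝ)
    (x : ℝ → Fin (N + 1) → Fin n → ℝ) : ENNReal :=
  ∑ i : Fin N, ∫⁻ t in Ioi (0 : ℝ), ENNReal.ofReal
    ((x t 0 - x t i.succ) ⬝ᵥ Q *ᵥ (x t 0 - x t i.succ)
      + S.control K (ρ t) (x t) i ⬝ᵥ R *ᵥ S.control K (ρ t) (x t) i)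

/-- Worst-case performance over all norm-bounded interactions, for given initial states. -/
def worstCost (Q : Matrix (Fin n) (Fin n) ℝ) (R : Matrix (Fin p) (Fin p) ℝ)
    (K : Fin N → ℝ → Matrix (Fin p) (Fin n) ℝ) (ρ : ℝ → ℝ)
    (x₀ : Fin (N + 1) → Fin n → ℝ) : ENNReal :=
  ⨆ (Δ : S.Uncertainty) (_ : S.NormBounded Δ) (x : ℝ → Fin (N + 1) → Fin n → ℝ)
    (_ : S.IsTrajectory K ρ Δ x₀ x), S.cost Q R K ρ x

/-- The protocol with gains `K` solves the leader-follower tracking problem: for all initial states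
the worst-case performance is below a finite constant (which may depend on the initial states). -/
def SolvesTracking (Q : Matrix (Fin n) (Fin n) ℝ) (R : Matrix (Fin p) (Fin p) ℝ)
    (K : Fin N → ℝ → Matrix (Fin p) (Fin n) ℝ) (ρ : ℝ → ℝ) : Prop :=
  ∀ x₀ : Fin (N + 1) → Fin n → ℝ, ∃ c : ℝ, S.worstCost Q R K ρ x₀ < ENNReal.ofReal c

end MultiAgentSystem

/-! ### The linear matrix inequalities -/

/-- Decision variables of the LMIs. `ν i j`, `μ i j` are used for coupling edges `(j, i)` between
followers, `ν₀ i` stands for `ν_{i0}` (used if the leader influences `i`) and `μ₀ i` for `μ_{0i}`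
(used if `i` influences the leader). -/
structure LMIVars (N n : ℕ) where
  Y : Matrix (Fin n) (Fin n) ℝ
  π : Fin N → ℝ
  ν : Fin N → Fin N → ℝ
  μ : Fin N → Fin N → ℝ
  ν₀ : Fin N → ℝ
  μ₀ : Fin N → ℝ

namespace MultiAgentSystem

variable (S : MultiAgentSystem N n p m)

/-- The matrix `Q̄ = (σ² / λ̂) Q`. -/
def Qbar (Q : Matrix (Fin n) (Fin n) ℝ) : Matrix (Fin n) (Fin n) ℝ :=
  (sigma S.comm ^ 2 / lambdaHat S.comm) • Q

/-- Row indices of the blocks `2, …, 7` of the LMI matrix of follower `i`. The last two blocks are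
empty unless the leader influences `i`, respectively `i` influences the leader. -/
abbrev LMIIndex (i : Fin N) : Type :=
  Fin n ⊕
  ({k : Σ j : Fin N, Fin (S.rows i.succ j.succ) // S.coupling.Adj k.1.succ i.succ} ⊕
  ({k : Σ j : Fin N, Fin (S.rows j.succ i.succ) // S.coupling.Adj i.succ k.1.succ} ⊕
  (Fin n ⊕
  ({_k : Fin (S.rows i.succ 0) // S.coupling.Adj 0 i.succ} ⊕
  {_k : Fin (S.rows 0 i.succ) // S.coupling.Adj i.succ 0}))))

open scoped MatrixOrder in
/-- The block row `[Q̄^{1/2}, Ĉ_i', C̄_i', I, C_{i0}', C_{0i}']`. -/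
def LMICols (Q : Matrix (Fin n) (Fin n) ℝ) (i : Fin N) : Matrix (Fin n) (S.LMIIndex i) ℝ :=
  fromCols (CFC.sqrt (S.Qbar Q)) <|
  fromCols (Matrix.of fun a k => S.C i.succ k.1.1.succ k.1.2 a) <|
  fromCols (Matrix.of fun a k => S.C k.1.1.succ i.succ k.1.2 a) <|
  fromCols 1 <|
  fromCols (Matrix.of fun a k => S.C i.succ 0 k.1 a) <|
  (Matrix.of fun a k => S.C 0 i.succ k.1 a)

/-- The diagonal of `diag(I, Φ_i, Ω_i, Λ_i, ν_{i0}⁻¹ I, (N μ_{0i})⁻¹ I)`. -/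
def LMIDiag (v : LMIVars N n) (i : Fin N) : S.LMIIndex i → ℝ :=
  Sum.elim (fun _ => 1) <|
  Sum.elim (fun k => 1 / v.ν i k.1.1) <|
  Sum.elim (fun k => 1 / v.μ k.1.1 i) <|
  Sum.elim (fun _ => 1 / v.π i) <|
  Sum.elim (fun _ => 1 / v.ν₀ i) (fun _ => 1 / (N * v.μ₀ i))

open Classical in
/-- The upper left block `Z_i` of the LMI matrix at the parameter value `r`. -/
def LMIHead (R : Matrix (Fin p) (Fin p) ℝ) (r β : ℝ) (v : LMIVars N n) (i : Fin N) :
    Matrix (Fin n) (Fin n) ℝ :=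
  S.A r * v.Y + v.Y * (S.A r)ᵀ - S.B₁ * R⁻¹ * S.B₁ᵀ + (1 / v.π i * β ^ 2) • 1
    + ((∑ j : Fin N, if S.coupling.Adj j.succ i.succ then 1 / v.ν i j + 1 / v.μ i j else 0)
        + (if S.coupling.Adj 0 i.succ then 1 / v.ν₀ i else 0)
        + ∑ k : Fin N, if S.coupling.Adj k.succ 0 then 1 / v.μ₀ k else 0) • (S.B₂ * S.B₂ᵀ)

open Classical in
/-- The matrix `Π_i`. -/
def LMIMatrix (Q : Matrix (Fin n) (Fin n) ℝ) (R : Matrix (Fin p) (Fin p) ℝ) (r β : ℝ)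
    (v : LMIVars N n) (i : Fin N) : Matrix (Fin n ⊕ S.LMIIndex i) (Fin n ⊕ S.LMIIndex i) ℝ :=
  fromBlocks (S.LMIHead R r β v i) (v.Y * S.LMICols Q i)
    ((S.LMICols Q i)ᵀ * v.Y) (-Matrix.diagonal (S.LMIDiag v i))

/-- `v` is a feasible solution of the coupled LMIs `Π_i < 0`, `i = 1, …, N`, at the parameter value
`r` with the constant `β`. -/
structure Feasible (Q : Matrix (Fin n) (Fin n) ℝ) (R : Matrix (Fin p) (Fin p) ℝ) (r β : ℝ)
    (v : LMIVars N n) : Prop where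
  Y_pos : v.Y.PosDef
  π_pos : ∀ i, 0 < v.π i
  ν_pos : ∀ i j, S.coupling.Adj j.succ i.succ → 0 < v.ν i j
  μ_pos : ∀ i j, S.coupling.Adj j.succ i.succ → 0 < v.μ i j
  ν₀_pos : ∀ i, S.coupling.Adj 0 i.succ → 0 < v.ν₀ i
  μ₀_pos : ∀ i, S.coupling.Adj i.succ 0 → 0 < v.μ₀ i
  lmi : ∀ i, (-S.LMIMatrix Q R r β v i).PosDef

end MultiAgentSystem

/-! ### Design points and interpolation -/

/-- Design data: design points `ρ_0 < … < ρ_M`, constants `β_s`, a collection of LMI variables for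
each design point, and for neighbouring design points `ρ_s, ρ_{s+1}` the corner points
`lo s < hi s` between which the interpolation takes place. -/
structure Design (M N n : ℕ) where
  point : Fin (M + 1) → ℝ
  β : Fin (M + 1) → ℝ
  sol : Fin (M + 1) → LMIVars N n
  lo : Fin M → ℝ
  hi : Fin M → ℝ

namespace Design

variable {M : ℕ} (D : Design M N n)

/-- The set of corner points. -/
def corners : Set ℝ := range D.lo ∪ range D.hi

/-- The interpolation weight `(hi s - r) / (hi s - lo s)`, cut off to `[0, 1]`: it is `1` to the
left of `lo s` and `0` to the right of `hi s`. -/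
def weight (s : Fin M) (r : ℝ) : ℝ := max 0 (min 1 ((D.hi s - r) / (D.hi s - D.lo s)))

/-- The scheduled matrix `Y_ρ` at `ρ = r`, as a telescoping sum. For `r` between `ρ_s` and `ρ_{s+1}`
it equals `γ Y_s + (1 - γ) Y_{s+1}` with `γ = weight s r` (see `schedY_eq`); it is constant to the
left of the first and to the right of the last design point. -/
def schedY (r : ℝ) : Matrix (Fin n) (Fin n) ℝ :=
  (D.sol 0).Y + ∑ s : Fin M, (1 - D.weight s r) • ((D.sol s.succ).Y - (D.sol s.castSucc).Y)

/-- The corner points lie strictly between the neighbouring design points. -/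
def Ordered : Prop :=
  ∀ s : Fin M, D.point s.castSucc < D.lo s ∧ D.lo s < D.hi s ∧ D.hi s < D.point s.succ

/-- Admissible design on the parameter interval `[a, b]`: the design points and corner points are
ordered and lie in `[a, b]`, the constants `β_s` are positive and bound the variation of `A` in the
sense `(A(r) - A(ρ_s))' (A(r) - A(ρ_s)) ≤ β_s² I` on the parameter ranges served by `ρ_s`, and `sol s`
is a feasible solution of the LMIs at `ρ_s`. -/
structure Admissible {p m : ℕ} (S : MultiAgentSystem N n p m) (Q : Matrix (Fin n) (Fin n) ℝ)
    (R : Matrix (Fin p) (Fin p) ℝ) (a b : ℝ) : Prop where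
  ordered : D.Ordered
  mem : ∀ s, D.point s ∈ Icc a b
  β_pos : ∀ s, 0 < D.β s
  right : ∀ (s : Fin M) (r : ℝ), r ∈ Ico (D.point s.castSucc) (D.hi s) →
    (D.β s.castSucc ^ 2 • (1 : Matrix (Fin n) (Fin n) ℝ)
      - (S.A r - S.A (D.point s.castSucc))ᵀ * (S.A r - S.A (D.point s.castSucc))).PosSemidef
  left : ∀ (s : Fin M) (r : ℝ), r ∈ Ico (D.lo s) (D.point s.succ) →
    (D.β s.succ ^ 2 • (1 : Matrix (Fin n) (Fin n) ℝ)
      - (S.A r - S.A (D.point s.succ))ᵀ * (S.A r - S.A (D.point s.succ))).PosSemidef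
  first : ∀ r ∈ Icc a (D.point 0),
    (D.β 0 ^ 2 • (1 : Matrix (Fin n) (Fin n) ℝ)
      - (S.A r - S.A (D.point 0))ᵀ * (S.A r - S.A (D.point 0))).PosSemidef
  last : ∀ r ∈ Icc (D.point (Fin.last M)) b,
    (D.β (Fin.last M) ^ 2 • (1 : Matrix (Fin n) (Fin n) ℝ)
      - (S.A r - S.A (D.point (Fin.last M)))ᵀ
        * (S.A r - S.A (D.point (Fin.last M)))).PosSemidef
  feasible : ∀ s, S.Feasible Q R (D.point s) (D.β s) (D.sol s)

/-- The scheduled gains `K_i(ρ) = -(ϑ_i σ)⁻¹ R⁻¹ B₁' Y_ρ⁻¹`. -/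
def gain {p m : ℕ} (S : MultiAgentSystem N n p m) (R : Matrix (Fin p) (Fin p) ℝ) (i : Fin N)
    (r : ℝ) : Matrix (Fin p) (Fin n) ℝ :=
  -((theta S.comm i * sigma S.comm)⁻¹ • (R⁻¹ * S.B₁ᵀ * (D.schedY r)⁻¹))

open scoped Matrix.Norms.L2Operator in
/-- `ϱ`: the supremum over `[a, b]`, without the corner points, of the spectral norm of
`d Y_ρ⁻¹ / dρ`. -/
def varrho (a b : ℝ) : ℝ :=
  sSup ((fun r => ‖deriv (fun r' => (D.schedY r')⁻¹) r‖) '' (Icc a b \ D.corners))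

/-- `η`: the minimum over `[a, b]` of `λ_min (Y_ρ⁻¹ B₁ R⁻¹ B₁' Y_ρ⁻¹ + Q̄)`. -/
def eta {p m : ℕ} (S : MultiAgentSystem N n p m) (Q : Matrix (Fin n) (Fin n) ℝ)
    (R : Matrix (Fin p) (Fin p) ℝ) (a b : ℝ) : ℝ :=
  sInf ((fun r => lambdaMin ((D.schedY r)⁻¹ * S.B₁ * R⁻¹ * S.B₁ᵀ * (D.schedY r)⁻¹ + S.Qbar Q)) ''
    Icc a b)

section Piecewise

variable {D}

theorem weight_of_le (h : D.Ordered) {s : Fin M} {r : ℝ} (hr : r ≤ D.lo s) : D.weight s r = 1 := by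
  have := (h s).2.1
  have h1 : 1 ≤ (D.hi s - r) / (D.hi s - D.lo s) := by
    rw [le_div_iff₀ (by linarith)]; linarith
  simp [weight, min_eq_left h1]

theorem weight_of_ge (h : D.Ordered) {s : Fin M} {r : ℝ} (hr : D.hi s ≤ r) : D.weight s r = 0 := by
  have := (h s).2.1
  have h1 : (D.hi s - r) / (D.hi s - D.lo s) ≤ 0 :=
    div_nonpos_of_nonpos_of_nonneg (by linarith) (by linarith)
  simp only [weight]
  exact max_eq_left ((min_le_right _ _).trans h1)

theorem weight_of_mem (h : D.Ordered) {s : Fin M} {r : ℝ} (hr : r ∈ Icc (D.lo s) (D.hi s)) :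
    D.weight s r = (D.hi s - r) / (D.hi s - D.lo s) := by
  have := (h s).2.1
  have h1 : (D.hi s - r) / (D.hi s - D.lo s) ≤ 1 := by
    rw [div_le_one (by linarith)]; linarith [hr.1]
  have h2 : 0 ≤ (D.hi s - r) / (D.hi s - D.lo s) :=
    div_nonneg (by linarith [hr.2]) (by linarith)
  simp only [weight]
  rw [min_eq_right h1, max_eq_right h2]

theorem point_strictMono (h : D.Ordered) : StrictMono D.point :=
  Fin.strictMono_iff_lt_succ.2 fun s => (h s).1.trans ((h s).2.1.trans (h s).2.2)

theorem telescope {E : Type*} [AddCommGroup E] {M : ℕ} (f : Fin (M + 1) → E) (s : Fin (M + 1)) :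
    f 0 + ∑ k : Fin M, (if k.castSucc < s then f k.succ - f k.castSucc else 0) = f s := by
  induction M with
  | zero => simp [Fin.fin_one_eq_zero s]
  | succ M ih =>
    induction s using Fin.cases with
    | zero => simp
    | succ s =>
      rw [Fin.sum_univ_succ]
      have h2 := ih (fun k => f k.succ) s
      simp only [Fin.castSucc_zero, Fin.succ_pos, if_true]
      rw [← h2, ← add_assoc, add_sub_cancel]
      congr 1
      refine Finset.sum_congr rfl fun k _ => ?_
      simp only [← Fin.succ_castSucc, Fin.succ_lt_succ_iff]

/-- `schedY` is the piecewise-defined interpolation: between neighbouring design points it equals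
`γ Y_s + (1 - γ) Y_{s+1}`, where `γ = 1` up to `lo s`, `γ = (hi s - r) / (hi s - lo s)` on
`[lo s, hi s]` and `γ = 0` from `hi s` on (`weight_of_le`, `weight_of_mem`, `weight_of_ge`). -/
theorem schedY_eq (h : D.Ordered) (s : Fin M) {r : ℝ}
    (hr : r ∈ Icc (D.point s.castSucc) (D.point s.succ)) :
    D.schedY r = D.weight s r • (D.sol s.castSucc).Y
      + (1 - D.weight s r) • (D.sol s.succ).Y := by
  have hmono := (point_strictMono h).monotone
  have key : ∀ k : Fin M, (1 - D.weight k r) • ((D.sol k.succ).Y - (D.sol k.castSucc).Y)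
      = (if k.castSucc < s.castSucc then (D.sol k.succ).Y - (D.sol k.castSucc).Y else 0)
        + if k = s then (1 - D.weight s r) • ((D.sol s.succ).Y - (D.sol s.castSucc).Y) else 0 := by
    intro k
    rcases lt_trichotomy k s with hk | hk | hk
    · have h1 : D.point k.succ ≤ D.point s.castSucc := hmono (Fin.succ_le_castSucc_iff.2 hk)
      have : D.weight k r = 0 := weight_of_ge h (by linarith [(h k).2.2, hr.1])
      rw [this, if_pos (Fin.castSucc_lt_castSucc_iff.2 hk), if_neg hk.ne, sub_zero, one_smul,
        add_zero]
    · subst hk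
      rw [if_neg (lt_irrefl _), if_pos rfl, zero_add]
    · have h1 : D.point s.succ ≤ D.point k.castSucc := hmono (Fin.succ_le_castSucc_iff.2 hk)
      have : D.weight k r = 1 := weight_of_le h (by linarith [(h k).1, hr.2])
      rw [this, if_neg (fun h' => hk.not_gt (Fin.castSucc_lt_castSucc_iff.1 h')), if_neg hk.ne',
        sub_self, zero_smul, add_zero]
  unfold schedY
  rw [Finset.sum_congr rfl fun k _ => key k, Finset.sum_add_distrib, ← add_assoc,
    telescope (fun k => (D.sol k).Y) s.castSucc, Finset.sum_ite_eq' Finset.univ s]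
  simp only [Finset.mem_univ, if_true]
  module

end Piecewise

end Design

end LeaderFollower

end

/-! The sum `V = ∑ e_i' Y_ρ⁻¹ e_i` over the tracking errors `e_i = x_0 - x_i` is a Lyapunov function.

*Linear algebra.* Expressed in the errors, the protocol applies the pinned Laplacian `L + G` to the
vectors `Y_ρ⁻¹ e_j`. The lower bound `σ` for the quadratic form of `Θ⁻¹ (L + G)` carries over to block
forms (`le_sum_sum_mul_of_posSemidef`), so the control contributes at most
`-2 ∑ e_i' Y_ρ⁻¹ B₁ R⁻¹ B₁' Y_ρ⁻¹ e_i` to the derivative of `V`; similarly `λ̂` bounds the control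
cost. The interactions are estimated by Young's inequality, channel by channel.

*The LMIs.* At a design point the LMI is used as an inequality of quadratic forms in `(ξ, w)`, not
through Schur complements. The coordinates of `w` in the block of `π_i` are spent on replacing
`A(ρ_s)` by `A(ρ)` (`Feasible.reducedLMI`). What remains is affine in `Y` and in the reciprocals of the
other constants, hence survives the interpolation of neighbouring solutions (`ReducedLMI.mix`), and a
good choice of `w` turns it into the Riccati inequality that absorbs the interaction terms
(`ReducedLMI.riccati`). Together this is `dissipation`: for frozen `Y_ρ`, `V` decreases at least at the
rate `W = ∑ e_i' (Y_ρ⁻¹ B₁ R⁻¹ B₁' Y_ρ⁻¹ + Q̄) e_i`, and the running cost is at most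
`(λ̂ / σ²) W` (`running_cost_le`).

*Time dependence of `Y_ρ`.* The function `ρ ↦ Y_ρ⁻¹` is Lipschitz with constant `ϱ`, because the
corners form a null set (`norm_schedY_inv_sub_le`). With the rate condition and the mean value
inequality, `t ↦ Y_{ρ(t)}⁻¹` is Lipschitz with constant `η q` (`norm_schedY_inv_comp_sub_le`). This
makes `V` absolutely continuous and costs at most `η q ∑ |e_i|² ≤ q W` in its derivative
(`deriv_lyapunov_le`), without any chain rule at the corners and also if `ϱ = 0`. Hence
`V' ≤ -(1 - q) W` almost everywhere, and integration over `[0, ∞)` gives the bound. -/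

noncomputable section

namespace LeaderFollower

/-! ### Quadratic forms and extreme eigenvalues -/

section QuadraticForms

theorem nonneg_dotProduct_mulVec {ι : Type*} [Fintype ι] {M : Matrix ι ι ℝ} (hM : M.PosSemidef)
    (v : ι → ℝ) : 0 ≤ v ⬝ᵥ M *ᵥ v := by
  simpa using hM.dotProduct_mulVec_nonneg v

theorem dotProduct_self_nonneg' {ι : Type*} [Fintype ι] (v : ι → ℝ) : 0 ≤ v ⬝ᵥ v :=
  Finset.sum_nonneg fun i _ => mul_self_nonneg (v i)

theorem dotProduct_mulVec_comm {ι κ : Type*} [Fintype ι] [Fintype κ] (M : Matrix ι κ ℝ)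
    (v : ι → ℝ) (w : κ → ℝ) : v ⬝ᵥ M *ᵥ w = (Mᵀ *ᵥ v) ⬝ᵥ w := by
  rw [dotProduct_mulVec, mulVec_transpose]

/-- Young's inequality for a positive weight `c`. -/
theorem two_mul_dotProduct_le {ι : Type*} [Fintype ι] {c : ℝ} (hc : 0 < c) (v w : ι → ℝ) :
    2 * (v ⬝ᵥ w) ≤ 1 / c * (v ⬝ᵥ v) + c * (w ⬝ᵥ w) := by
  simp only [dotProduct, Finset.mul_sum]
  rw [← Finset.sum_add_distrib]
  refine Finset.sum_le_sum fun i _ => ?_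
  have h : 1 / c * (v i * v i) + c * (w i * w i) - 2 * (v i * w i)
      = 1 / c * (v i - c * w i) ^ 2 := by
    field_simp
    ring
  have h2 : 0 ≤ 1 / c * (v i - c * w i) ^ 2 := by positivity
  linarith

variable {k : ℕ}

theorem lambdaMin_mul_le {M : Matrix (Fin k) (Fin k) ℝ} (hM : M.IsHermitian) (v : Fin k → ℝ) :
    lambdaMin M * (v ⬝ᵥ v) ≤ v ⬝ᵥ M *ᵥ v := by
  have hps : (M - algebraMap ℝ (Matrix (Fin k) (Fin k) ℝ) (lambdaMin M)).PosSemidef := by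
    refine posSemidef_iff_isHermitian_and_spectrum_nonneg.2 ⟨hM.sub ?_, ?_⟩
    · rw [Algebra.algebraMap_eq_smul_one]
      exact isHermitian_one.smul (IsSelfAdjoint.all _)
    · rw [← spectrum.sub_singleton_eq]
      rintro _ ⟨x, hx, y, rfl, rfl⟩
      exact sub_nonneg.2 (csInf_le M.finite_real_spectrum.bddBelow hx)
  have h := nonneg_dotProduct_mulVec hps v
  rw [Algebra.algebraMap_eq_smul_one, sub_mulVec, dotProduct_sub, smul_mulVec, one_mulVec,
    dotProduct_smul, smul_eq_mul] at h
  linarith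

theorem le_lambdaMax_mul {M : Matrix (Fin k) (Fin k) ℝ} (hM : M.IsHermitian) (v : Fin k → ℝ) :
    v ⬝ᵥ M *ᵥ v ≤ lambdaMax M * (v ⬝ᵥ v) := by
  have hps : (algebraMap ℝ (Matrix (Fin k) (Fin k) ℝ) (lambdaMax M) - M).PosSemidef := by
    refine posSemidef_iff_isHermitian_and_spectrum_nonneg.2 ⟨IsHermitian.sub ?_ hM, ?_⟩
    · rw [Algebra.algebraMap_eq_smul_one]
      exact isHermitian_one.smul (IsSelfAdjoint.all _)
    · rw [← spectrum.singleton_sub_eq]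
      rintro _ ⟨y, rfl, x, hx, rfl⟩
      exact sub_nonneg.2 (le_csSup M.finite_real_spectrum.bddAbove hx)
  have h := nonneg_dotProduct_mulVec hps v
  rw [Algebra.algebraMap_eq_smul_one, sub_mulVec, dotProduct_sub, smul_mulVec, one_mulVec,
    dotProduct_smul, smul_eq_mul] at h
  linarith

theorem lambdaMin_nonneg {M : Matrix (Fin k) (Fin k) ℝ} (hM : M.PosSemidef) : 0 ≤ lambdaMin M :=
  Real.sInf_nonneg fun _ hx => (posSemidef_iff_isHermitian_and_spectrum_nonneg.1 hM).2 hx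

theorem lambdaMin_pos [Nonempty (Fin k)] {M : Matrix (Fin k) (Fin k) ℝ} (hM : M.PosDef) :
    0 < lambdaMin M := by
  have hmem : lambdaMin M ∈ spectrum ℝ M := by
    refine Nonempty.csInf_mem ?_ M.finite_real_spectrum
    rw [hM.1.spectrum_real_eq_range_eigenvalues]
    exact range_nonempty _
  rw [hM.1.spectrum_real_eq_range_eigenvalues] at hmem
  obtain ⟨i, hi⟩ := hmem
  rw [← hi]
  exact hM.eigenvalues_pos i

open scoped MatrixOrder in
/-- A quadratic form bound for `M` carries over to the block form `M ⊗ G` with `G ≥ 0`: factor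
`G = F' F` and apply the bound to every row of the matrix with columns `F p_i`. -/
theorem le_sum_sum_mul_of_posSemidef {N n : ℕ} {M : Matrix (Fin N) (Fin N) ℝ} {c : ℝ}
    (h : ∀ v, c * (v ⬝ᵥ v) ≤ v ⬝ᵥ M *ᵥ v) {G : Matrix (Fin n) (Fin n) ℝ} (hG : G.PosSemidef)
    (y : Fin N → Fin n → ℝ) :
    c * ∑ i, y i ⬝ᵥ G *ᵥ y i ≤ ∑ i, ∑ j, M i j * (y i ⬝ᵥ G *ᵥ y j) := by
  obtain ⟨F, rfl⟩ := CStarAlgebra.nonneg_iff_eq_star_mul_self.mp hG.nonneg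
  have hF : ∀ i j, y i ⬝ᵥ (star F * F) *ᵥ y j = ∑ l, (F *ᵥ y i) l * (F *ᵥ y j) l := by
    intro i j
    rw [← mulVec_mulVec, dotProduct_mulVec_comm, star_eq_conjTranspose,
      conjTranspose_eq_transpose_of_trivial, transpose_transpose]
    rfl
  simp only [hF]
  calc c * ∑ i, ∑ l, (F *ᵥ y i) l * (F *ᵥ y i) l
      = ∑ l, c * ((fun i => (F *ᵥ y i) l) ⬝ᵥ fun i => (F *ᵥ y i) l) := by
        rw [Finset.sum_comm, Finset.mul_sum]
        rfl
    _ ≤ ∑ l, (fun i => (F *ᵥ y i) l) ⬝ᵥ M *ᵥ fun i => (F *ᵥ y i) l :=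
        Finset.sum_le_sum fun l _ => h _
    _ = ∑ i, ∑ j, M i j * ∑ l, (F *ᵥ y i) l * (F *ᵥ y j) l := by
        simp only [dotProduct, mulVec, Finset.mul_sum]
        rw [Finset.sum_comm]
        refine Finset.sum_congr rfl fun i _ => ?_
        rw [Finset.sum_comm]
        refine Finset.sum_congr rfl fun j _ => Finset.sum_congr rfl fun l _ => ?_
        simp only [← Finset.mul_sum]
        ring

theorem sum_sum_mul_le_of_posSemidef {N n : ℕ} {M : Matrix (Fin N) (Fin N) ℝ} {c : ℝ}
    (h : ∀ v, v ⬝ᵥ M *ᵥ v ≤ c * (v ⬝ᵥ v)) {G : Matrix (Fin n) (Fin n) ℝ} (hG : G.PosSemidef)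
    (y : Fin N → Fin n → ℝ) :
    ∑ i, ∑ j, M i j * (y i ⬝ᵥ G *ᵥ y j) ≤ c * ∑ i, y i ⬝ᵥ G *ᵥ y i := by
  have := le_sum_sum_mul_of_posSemidef (M := -M) (c := -c)
    (fun v => by rw [neg_mulVec, dotProduct_neg]; linarith [h v]) hG y
  simp only [Matrix.neg_apply, neg_mul, Finset.sum_neg_distrib] at this
  linarith

end QuadraticForms

/-! ### The pinned Laplacian -/

section Graph

variable {N : ℕ} {G : Digraph (Fin (N + 1))}

/-- If some `ϑ_i` vanished, then `Θ⁻¹` and with it `symTheta G` would be zero, since the inverse of a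
singular matrix is `0`. -/
theorem theta_ne_zero (h : (symTheta G).PosDef) (i : Fin N) : theta G i ≠ 0 := by
  intro hi
  have hdet : (Theta G).det = 0 := by
    rw [Theta, det_diagonal]
    exact Finset.prod_eq_zero (Finset.mem_univ i) hi
  have hinv : (Theta G)⁻¹ = 0 := nonsing_inv_apply_not_isUnit _ (by simp [hdet])
  have h0 : symTheta G = 0 := by simp [symTheta, hinv]
  have := h.diag_pos (i := i)
  simp [h0] at this

theorem Theta_inv (h : (symTheta G).PosDef) : (Theta G)⁻¹ = diagonal fun i => (theta G i)⁻¹ := by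
  refine inv_eq_right_inv ?_
  rw [Theta, diagonal_mul_diagonal, ← diagonal_one]
  congr 1
  funext i
  exact mul_inv_cancel₀ (theta_ne_zero h i)

theorem sigma_pos [Nonempty (Fin N)] (h : (symTheta G).PosDef) : 0 < sigma G := by
  have := lambdaMin_pos h
  unfold sigma
  positivity

theorem dotProduct_symTheta (G : Digraph (Fin (N + 1))) (v : Fin N → ℝ) :
    v ⬝ᵥ symTheta G *ᵥ v = 2 * (v ⬝ᵥ ((Theta G)⁻¹ * pinnedLaplacian G) *ᵥ v) := by
  have hT : (Theta G)⁻¹ᵀ = (Theta G)⁻¹ := by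
    rw [transpose_nonsing_inv, Theta, diagonal_transpose]
  have : (pinnedLaplacian G)ᵀ * (Theta G)⁻¹ = ((Theta G)⁻¹ * pinnedLaplacian G)ᵀ := by
    rw [transpose_mul, hT]
  rw [symTheta, this, add_mulVec, dotProduct_add, dotProduct_mulVec_comm _ᵀ, transpose_transpose,
    dotProduct_comm (_ *ᵥ v) v]
  ring

theorem sigma_mul_le (h : (symTheta G).PosDef) (v : Fin N → ℝ) :
    sigma G * (v ⬝ᵥ v) ≤ v ⬝ᵥ ((Theta G)⁻¹ * pinnedLaplacian G) *ᵥ v := by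
  have := lambdaMin_mul_le h.1 v
  rw [dotProduct_symTheta] at this
  rw [sigma]
  linarith

/-- The matrix `(L + G)' Θ⁻² (L + G)` whose largest eigenvalue is `λ̂`. -/
abbrev gramTheta (G : Digraph (Fin (N + 1))) : Matrix (Fin N) (Fin N) ℝ :=
  (pinnedLaplacian G)ᵀ * ((Theta G)⁻¹ * (Theta G)⁻¹) * pinnedLaplacian G

theorem gramTheta_eq (G : Digraph (Fin (N + 1))) :
    gramTheta G = ((Theta G)⁻¹ * pinnedLaplacian G)ᵀ * ((Theta G)⁻¹ * pinnedLaplacian G) := by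
  have hT : (Theta G)⁻¹ᵀ = (Theta G)⁻¹ := by
    rw [transpose_nonsing_inv, Theta, diagonal_transpose]
  rw [transpose_mul, hT]
  simp only [Matrix.mul_assoc]

theorem dotProduct_gramTheta_le (G : Digraph (Fin (N + 1))) (v : Fin N → ℝ) :
    v ⬝ᵥ gramTheta G *ᵥ v ≤ lambdaHat G * (v ⬝ᵥ v) := by
  refine le_lambdaMax_mul ?_ v
  have := isHermitian_conjTranspose_mul_self ((Theta G)⁻¹ * pinnedLaplacian G)
  rwa [conjTranspose_eq_transpose_of_trivial, ← gramTheta_eq] at this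

theorem lambdaHat_pos [Nonempty (Fin N)] (h : (symTheta G).PosDef) : 0 < lambdaHat G := by
  set v : Fin N → ℝ := fun _ => 1
  have hv : 0 < v ⬝ᵥ v := by
    simp only [v, dotProduct, mul_one, Finset.sum_const, Finset.card_univ, nsmul_eq_mul]
    exact_mod_cast Fintype.card_pos
  have h1 := dotProduct_gramTheta_le G v
  set w := ((Theta G)⁻¹ * pinnedLaplacian G) *ᵥ v
  have h2 : v ⬝ᵥ gramTheta G *ᵥ v = w ⬝ᵥ w := by
    rw [gramTheta_eq, ← mulVec_mulVec, dotProduct_mulVec_comm, transpose_transpose]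
  have hw : w ≠ 0 := by
    intro hw
    have := sigma_mul_le h v
    rw [show ((Theta G)⁻¹ * pinnedLaplacian G) *ᵥ v = 0 from hw, dotProduct_zero] at this
    nlinarith [sigma_pos h]
  have hww : 0 < w ⬝ᵥ w :=
    (dotProduct_self_nonneg' w).lt_of_ne fun h0 => hw (dotProduct_self_eq_zero.1 h0.symm)
  rw [h2] at h1
  by_contra hl
  nlinarith

end Graph

variable {N n p m M : ℕ}

/-! ### From the LMIs to a Riccati inequality -/

theorem sum_subtype_sigma {c : Fin N → ℕ} (P : Fin N → Prop) [DecidablePred P]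
    [Fintype {k : Σ j : Fin N, Fin (c j) // P k.1}] (f : ∀ j, Fin (c j) → ℝ) :
    ∑ k : {k : Σ j : Fin N, Fin (c j) // P k.1}, f k.1.1 k.1.2
      = ∑ j, if P j then ∑ l, f j l else 0 := by
  rw [← Finset.sum_subtype (Finset.univ.filter fun k : Σ j : Fin N, Fin (c j) => P k.1) (by simp)
    (fun k => f k.1 k.2), Finset.sum_filter, Fintype.sum_sigma]
  refine Finset.sum_congr rfl fun j _ => ?_
  split_ifs <;> simp

theorem sum_subtype_const {c : ℕ} (P : Prop) [Decidable P] [Fintype {_k : Fin c // P}]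
    (f : Fin c → ℝ) : ∑ k : {_k : Fin c // P}, f k.1 = if P then ∑ l, f l else 0 := by
  rw [← Finset.sum_subtype (Finset.univ.filter fun _ : Fin c => P)
    (fun x => by rw [Finset.mem_filter]; simp) f, Finset.sum_filter]
  split_ifs <;> simp

namespace MultiAgentSystem

variable (S : MultiAgentSystem N n p m)

open Classical in
/-- The coefficient of `B₂ B₂'` in the upper left block of the LMI matrix of follower `i`. -/
def couplingWeight (v : LMIVars N n) (i : Fin N) : ℝ :=
  (∑ j : Fin N, if S.coupling.Adj j.succ i.succ then 1 / v.ν i j + 1 / v.μ i j else 0)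
    + (if S.coupling.Adj 0 i.succ then 1 / v.ν₀ i else 0)
    + ∑ k : Fin N, if S.coupling.Adj k.succ 0 then 1 / v.μ₀ k else 0

open Classical in
/-- The part of the quadratic form of the LMI matrix that couples `y = Y ξ` with the remaining
coordinates, for coordinates of the form `(Q̄^{1/2} e, f_j C_{ij} e, g_j C_{ji} e, f₀ C_{i0} e,
g₀ C_{0i} e)`. -/
def crossForm (Q : Matrix (Fin n) (Fin n) ℝ) (i : Fin N) (f g : Fin N → ℝ) (f₀ g₀ : ℝ)
    (y e : Fin n → ℝ) : ℝ :=
  y ⬝ᵥ S.Qbar Q *ᵥ e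
    + (∑ j : Fin N, if S.coupling.Adj j.succ i.succ then
        f j * ((S.C i.succ j.succ *ᵥ y) ⬝ᵥ (S.C i.succ j.succ *ᵥ e)) else 0)
    + (∑ j : Fin N, if S.coupling.Adj i.succ j.succ then
        g j * ((S.C j.succ i.succ *ᵥ y) ⬝ᵥ (S.C j.succ i.succ *ᵥ e)) else 0)
    + (if S.coupling.Adj 0 i.succ then
        f₀ * ((S.C i.succ 0 *ᵥ y) ⬝ᵥ (S.C i.succ 0 *ᵥ e)) else 0)
    + (if S.coupling.Adj i.succ 0 then
        g₀ * ((S.C 0 i.succ *ᵥ y) ⬝ᵥ (S.C 0 i.succ *ᵥ e)) else 0)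

/-- The constants of the decision variables are positive wherever they are used. -/
structure PosVars (v : LMIVars N n) : Prop where
  ν_pos : ∀ i j, S.coupling.Adj j.succ i.succ → 0 < v.ν i j
  μ_pos : ∀ i j, S.coupling.Adj j.succ i.succ → 0 < v.μ i j
  ν₀_pos : ∀ i, S.coupling.Adj 0 i.succ → 0 < v.ν₀ i
  μ₀_pos : ∀ i, S.coupling.Adj i.succ 0 → 0 < v.μ₀ i

/-- The LMIs at the parameter value `r` as inequalities between quadratic forms, after the block
that absorbs the variation of `A` has been eliminated. For fixed `ξ` and `e` the inequality is
affine in `(Y, 1/ν, 1/μ, 1/ν₀, 1/μ₀)`. -/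
def ReducedLMI (Q : Matrix (Fin n) (Fin n) ℝ) (R : Matrix (Fin p) (Fin p) ℝ) (r : ℝ)
    (v : LMIVars N n) : Prop :=
  ∀ (i : Fin N) (ξ e : Fin n → ℝ) (f g : Fin N → ℝ) (f₀ g₀ : ℝ),
    2 * (ξ ⬝ᵥ S.A r *ᵥ (v.Y *ᵥ ξ)) - ξ ⬝ᵥ (S.B₁ * R⁻¹ * S.B₁ᵀ) *ᵥ ξ
      + S.couplingWeight v i * ((S.B₂ᵀ *ᵥ ξ) ⬝ᵥ (S.B₂ᵀ *ᵥ ξ))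
      + 2 * S.crossForm Q i f g f₀ g₀ (v.Y *ᵥ ξ) e
    ≤ S.crossForm Q i (fun j => f j ^ 2 * (1 / v.ν i j)) (fun j => g j ^ 2 * (1 / v.μ j i))
        (f₀ ^ 2 * (1 / v.ν₀ i)) (g₀ ^ 2 * (1 / N * (1 / v.μ₀ i))) e e

theorem dotProduct_B₂ (ξ : Fin n → ℝ) :
    ξ ⬝ᵥ (S.B₂ * S.B₂ᵀ) *ᵥ ξ = (S.B₂ᵀ *ᵥ ξ) ⬝ᵥ (S.B₂ᵀ *ᵥ ξ) := by
  rw [← mulVec_mulVec, dotProduct_mulVec_comm]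

open scoped MatrixOrder in
/-- The square root of `Q̄` only enters through its square. -/
theorem dotProduct_sqrt_mulVec {M : Matrix (Fin n) (Fin n) ℝ} (hM : M.PosSemidef)
    (y e : Fin n → ℝ) :
    y ⬝ᵥ CFC.sqrt M *ᵥ (CFC.sqrt M *ᵥ e) = y ⬝ᵥ M *ᵥ e := by
  rw [mulVec_mulVec, CFC.sqrt_mul_sqrt_self M hM.nonneg]

open scoped MatrixOrder in
theorem transpose_sqrt (M : Matrix (Fin n) (Fin n) ℝ) : (CFC.sqrt M)ᵀ = CFC.sqrt M := by
  have h : (CFC.sqrt M).PosSemidef := (CFC.sqrt_nonneg M).posSemidef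
  rw [← conjTranspose_eq_transpose_of_trivial]
  exact h.1

variable {S}

open Classical in
/-- The LMI `Π_i < 0`, evaluated at `(ξ, w)`. -/
theorem Feasible.quadratic {Q : Matrix (Fin n) (Fin n) ℝ} {R : Matrix (Fin p) (Fin p) ℝ}
    {r β : ℝ} {v : LMIVars N n} (h : S.Feasible Q R r β v) (i : Fin N) (ξ : Fin n → ℝ)
    (w : S.LMIIndex i → ℝ) :
    ξ ⬝ᵥ S.LMIHead R r β v i *ᵥ ξ + 2 * ((v.Y *ᵥ ξ) ⬝ᵥ S.LMICols Q i *ᵥ w)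
      ≤ ∑ k, S.LMIDiag v i k * w k ^ 2 := by
  have hY : v.Yᵀ = v.Y := by
    rw [← conjTranspose_eq_transpose_of_trivial]
    exact h.Y_pos.1
  have h0 := nonneg_dotProduct_mulVec (h.lmi i).posSemidef (Sum.elim ξ w)
  rw [LMIMatrix, neg_mulVec, fromBlocks_mulVec, dotProduct_neg, Sum.elim_comp_inl,
    Sum.elim_comp_inr, sumElim_dotProduct_sumElim, dotProduct_add, dotProduct_add,
    ← mulVec_mulVec, ← mulVec_mulVec, dotProduct_mulVec_comm v.Y, hY,
    dotProduct_mulVec_comm _ᵀ, transpose_transpose, dotProduct_comm (S.LMICols Q i *ᵥ w),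
    neg_mulVec, dotProduct_neg] at h0
  have hd : w ⬝ᵥ diagonal (S.LMIDiag v i) *ᵥ w = ∑ k, S.LMIDiag v i k * w k ^ 2 := by
    simp only [dotProduct, mulVec_diagonal]
    exact Finset.sum_congr rfl fun k _ => by ring
  rw [hd] at h0
  linarith

open Classical in
open scoped MatrixOrder in
/-- A feasible solution of the LMIs at a design point yields the reduced inequality at every
parameter value at which `A` is `β`-close to its value at the design point. -/
theorem Feasible.reducedLMI {Q : Matrix (Fin n) (Fin n) ℝ} {R : Matrix (Fin p) (Fin p) ℝ}
    (hQ : (S.Qbar Q).PosSemidef)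
    {s r β : ℝ} (hβ : 0 < β) {v : LMIVars N n} (h : S.Feasible Q R s β v)
    (hA : (β ^ 2 • (1 : Matrix (Fin n) (Fin n) ℝ) - (S.A r - S.A s)ᵀ * (S.A r - S.A s)).PosSemidef) :
    S.ReducedLMI Q R r v := by
  intro i ξ e f g f₀ g₀
  set y := v.Y *ᵥ ξ with hy
  have hπ := h.π_pos i
  have hY : v.Yᵀ = v.Y := by
    rw [← conjTranspose_eq_transpose_of_trivial]
    exact h.Y_pos.1
  -- The block of `π` gets the optimal coordinates `π Y ξ`; those of the other blocks are built from
  -- `e`, which will later be common to the two solutions that are interpolated.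
  have key := h.quadratic i ξ <|
    Sum.elim (CFC.sqrt (S.Qbar Q) *ᵥ e) <|
    Sum.elim (fun k => f k.1.1 * (S.C i.succ k.1.1.succ *ᵥ e) k.1.2) <|
    Sum.elim (fun k => g k.1.1 * (S.C k.1.1.succ i.succ *ᵥ e) k.1.2) <|
    Sum.elim (v.π i • y) <|
    Sum.elim (fun k => f₀ * (S.C i.succ 0 *ᵥ e) k.1) (fun k => g₀ * (S.C 0 i.succ *ᵥ e) k.1)
  have hcross : y ⬝ᵥ S.LMICols Q i *ᵥ (
      Sum.elim (CFC.sqrt (S.Qbar Q) *ᵥ e) <|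
      Sum.elim (fun k => f k.1.1 * (S.C i.succ k.1.1.succ *ᵥ e) k.1.2) <|
      Sum.elim (fun k => g k.1.1 * (S.C k.1.1.succ i.succ *ᵥ e) k.1.2) <|
      Sum.elim (v.π i • y) <|
      Sum.elim (fun k => f₀ * (S.C i.succ 0 *ᵥ e) k.1) (fun k => g₀ * (S.C 0 i.succ *ᵥ e) k.1))
      = S.crossForm Q i f g f₀ g₀ y e + v.π i * (y ⬝ᵥ y) := by
    unfold LMICols crossForm
    simp only [fromCols_mulVec_sumElim, dotProduct_add, dotProduct_sqrt_mulVec hQ, one_mulVec,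
      dotProduct_smul, smul_eq_mul]
    rw [dotProduct_mulVec_comm (Matrix.of _), dotProduct_mulVec_comm (Matrix.of _),
      dotProduct_mulVec_comm (Matrix.of _), dotProduct_mulVec_comm (Matrix.of _)]
    have e1 := sum_subtype_sigma (fun j => S.coupling.Adj j.succ i.succ)
      (fun j l => (S.C i.succ j.succ *ᵥ y) l * (f j * (S.C i.succ j.succ *ᵥ e) l))
    have e2 := sum_subtype_sigma (fun j => S.coupling.Adj i.succ j.succ)
      (fun j l => (S.C j.succ i.succ *ᵥ y) l * (g j * (S.C j.succ i.succ *ᵥ e) l))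
    have e3 := sum_subtype_const (S.coupling.Adj 0 i.succ)
      (fun l => (S.C i.succ 0 *ᵥ y) l * (f₀ * (S.C i.succ 0 *ᵥ e) l))
    have e4 := sum_subtype_const (S.coupling.Adj i.succ 0)
      (fun l => (S.C 0 i.succ *ᵥ y) l * (g₀ * (S.C 0 i.succ *ᵥ e) l))
    have hl : ∀ {c : ℕ} (u z : Fin c → ℝ) (a : ℝ),
        ∑ l, u l * (a * z l) = a * (u ⬝ᵥ z) := fun u z a => by
      rw [dotProduct, Finset.mul_sum]
      exact Finset.sum_congr rfl fun l _ => by ring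
    simp only [hl] at e1 e2 e3 e4
    rw [← e1, ← e2, ← e3, ← e4]
    simp only [dotProduct, mulVec, Matrix.transpose_apply, of_apply]
    ring
  have hdiag : ∑ k, S.LMIDiag v i k * (
      Sum.elim (CFC.sqrt (S.Qbar Q) *ᵥ e) <|
      Sum.elim (fun k => f k.1.1 * (S.C i.succ k.1.1.succ *ᵥ e) k.1.2) <|
      Sum.elim (fun k => g k.1.1 * (S.C k.1.1.succ i.succ *ᵥ e) k.1.2) <|
      Sum.elim (v.π i • y) <|
      Sum.elim (fun k => f₀ * (S.C i.succ 0 *ᵥ e) k.1)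
        (fun k => g₀ * (S.C 0 i.succ *ᵥ e) k.1)) k ^ 2
      = S.crossForm Q i (fun j => f j ^ 2 * (1 / v.ν i j)) (fun j => g j ^ 2 * (1 / v.μ j i))
        (f₀ ^ 2 * (1 / v.ν₀ i)) (g₀ ^ 2 * (1 / N * (1 / v.μ₀ i))) e e + v.π i * (y ⬝ᵥ y) := by
    unfold LMIDiag crossForm
    simp only [Fintype.sum_sum_type, Sum.elim_inl, Sum.elim_inr]
    have e0 : ∑ k, 1 * (CFC.sqrt (S.Qbar Q) *ᵥ e) k ^ 2 = e ⬝ᵥ S.Qbar Q *ᵥ e := by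
      rw [← dotProduct_sqrt_mulVec hQ, dotProduct_mulVec_comm, transpose_sqrt, dotProduct]
      exact Finset.sum_congr rfl fun k _ => by ring
    have e1 := sum_subtype_sigma (fun j => S.coupling.Adj j.succ i.succ)
      (fun j l => 1 / v.ν i j * (f j * (S.C i.succ j.succ *ᵥ e) l) ^ 2)
    have e2 := sum_subtype_sigma (fun j => S.coupling.Adj i.succ j.succ)
      (fun j l => 1 / v.μ j i * (g j * (S.C j.succ i.succ *ᵥ e) l) ^ 2)
    have e3 := sum_subtype_const (S.coupling.Adj 0 i.succ)
      (fun l => 1 / v.ν₀ i * (f₀ * (S.C i.succ 0 *ᵥ e) l) ^ 2)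
    have e4 := sum_subtype_const (S.coupling.Adj i.succ 0)
      (fun l => 1 / (N * v.μ₀ i) * (g₀ * (S.C 0 i.succ *ᵥ e) l) ^ 2)
    have e5 : ∑ k, 1 / v.π i * (v.π i • y) k ^ 2 = v.π i * (y ⬝ᵥ y) := by
      rw [dotProduct, Finset.mul_sum]
      refine Finset.sum_congr rfl fun k _ => ?_
      simp only [Pi.smul_apply, smul_eq_mul]
      field_simp
    have hl : ∀ {c : ℕ} (u : Fin c → ℝ) (a b : ℝ),
        ∑ l, b * (a * u l) ^ 2 = a ^ 2 * b * (u ⬝ᵥ u) := fun u a b => by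
      rw [dotProduct, Finset.mul_sum]
      exact Finset.sum_congr rfl fun l _ => by ring
    simp only [hl] at e1 e2 e3 e4
    simp only [one_div_mul_one_div_rev, mul_comm (v.μ₀ i)]
    rw [e0, e1, e2, e3, e4, e5]
    ring
  rw [hcross, hdiag] at key
  have hhead : ξ ⬝ᵥ S.LMIHead R s β v i *ᵥ ξ
      = 2 * (ξ ⬝ᵥ S.A s *ᵥ y) - ξ ⬝ᵥ (S.B₁ * R⁻¹ * S.B₁ᵀ) *ᵥ ξ
        + 1 / v.π i * β ^ 2 * (ξ ⬝ᵥ ξ)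
        + S.couplingWeight v i * ((S.B₂ᵀ *ᵥ ξ) ⬝ᵥ (S.B₂ᵀ *ᵥ ξ)) := by
    unfold LMIHead couplingWeight
    rw [add_mulVec, add_mulVec, sub_mulVec, add_mulVec, smul_mulVec, smul_mulVec, one_mulVec,
      dotProduct_add, dotProduct_add, dotProduct_sub, dotProduct_add, dotProduct_smul,
      dotProduct_smul, smul_eq_mul, smul_eq_mul, S.dotProduct_B₂, ← mulVec_mulVec, ← mulVec_mulVec,
      dotProduct_mulVec_comm v.Y, hY, dotProduct_mulVec_comm _ᵀ, transpose_transpose,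
      dotProduct_comm (S.A s *ᵥ _)]
    ring
  -- The variation of `A` is paid for by `π |y|²` and the term `β² / π` of the head block.
  set d := (S.A r - S.A s) *ᵥ y with hd
  have hdy : d ⬝ᵥ d ≤ β ^ 2 * (y ⬝ᵥ y) := by
    have := nonneg_dotProduct_mulVec hA y
    rw [sub_mulVec, dotProduct_sub, smul_mulVec, one_mulVec, dotProduct_smul, smul_eq_mul,
      ← mulVec_mulVec, dotProduct_mulVec_comm _ᵀ, transpose_transpose] at this
    linarith
  have hAr : ξ ⬝ᵥ S.A r *ᵥ y = ξ ⬝ᵥ S.A s *ᵥ y + ξ ⬝ᵥ d := by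
    rw [hd, sub_mulVec, dotProduct_sub]
    ring
  have hyoung := two_mul_dotProduct_le (c := v.π i / β ^ 2) (by positivity) ξ d
  have h1 : v.π i / β ^ 2 * (d ⬝ᵥ d) ≤ v.π i * (y ⬝ᵥ y) := by
    calc v.π i / β ^ 2 * (d ⬝ᵥ d) ≤ v.π i / β ^ 2 * (β ^ 2 * (y ⬝ᵥ y)) := by gcongr
      _ = v.π i * (y ⬝ᵥ y) := by field_simp
  have h2 : 1 / (v.π i / β ^ 2) = 1 / v.π i * β ^ 2 := by field_simp
  rw [h2] at hyoung
  rw [hhead] at key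
  rw [hAr]
  linarith

end MultiAgentSystem

namespace MultiAgentSystem

/-! ### Interpolation of solutions of the LMIs -/

theorem crossForm_combo_left (S : MultiAgentSystem N n p m) (Q : Matrix (Fin n) (Fin n) ℝ)
    (i : Fin N) (f g : Fin N → ℝ) (f₀ g₀ a b : ℝ) (y y' e : Fin n → ℝ) :
    S.crossForm Q i f g f₀ g₀ (a • y + b • y') e
      = a * S.crossForm Q i f g f₀ g₀ y e + b * S.crossForm Q i f g f₀ g₀ y' e := by
  have hite : ∀ (P : Prop) [Decidable P] (c x x' : ℝ),
      (if P then c * (a * x + b * x') else 0)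
        = a * (if P then c * x else 0) + b * (if P then c * x' else 0) := by
    intro P _ c x x'
    split_ifs <;> ring
  simp only [crossForm, mulVec_add, mulVec_smul, add_dotProduct, smul_dotProduct, smul_eq_mul,
    hite, Finset.sum_add_distrib, ← Finset.mul_sum]
  ring

theorem crossForm_combo_coeff (S : MultiAgentSystem N n p m) (Q : Matrix (Fin n) (Fin n) ℝ)
    (i : Fin N) (f f' g g' : Fin N → ℝ) (f₀ f₀' g₀ g₀' : ℝ) {a b : ℝ} (hab : a + b = 1)
    (y e : Fin n → ℝ) :
    S.crossForm Q i (fun j => a * f j + b * f' j) (fun j => a * g j + b * g' j)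
        (a * f₀ + b * f₀') (a * g₀ + b * g₀') y e
      = a * S.crossForm Q i f g f₀ g₀ y e + b * S.crossForm Q i f' g' f₀' g₀' y e := by
  have hite : ∀ (P : Prop) [Decidable P] (c c' x : ℝ),
      (if P then (a * c + b * c') * x else 0)
        = a * (if P then c * x else 0) + b * (if P then c' * x else 0) := by
    intro P _ c c' x
    split_ifs <;> ring
  simp only [crossForm, hite, Finset.sum_add_distrib, ← Finset.mul_sum]
  linear_combination (-(y ⬝ᵥ S.Qbar Q *ᵥ e)) * hab

end MultiAgentSystem

/-- Interpolation of decision variables: arithmetic for `Y`, harmonic for the constants, since the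
LMIs are affine in the reciprocals of the constants. The constants `π` play no role in
`MultiAgentSystem.ReducedLMI`. -/
def LMIVars.mix (c : ℝ) (v v' : LMIVars N n) : LMIVars N n where
  Y := c • v.Y + (1 - c) • v'.Y
  π := v.π
  ν i j := (c * (1 / v.ν i j) + (1 - c) * (1 / v'.ν i j))⁻¹
  μ i j := (c * (1 / v.μ i j) + (1 - c) * (1 / v'.μ i j))⁻¹
  ν₀ i := (c * (1 / v.ν₀ i) + (1 - c) * (1 / v'.ν₀ i))⁻¹
  μ₀ i := (c * (1 / v.μ₀ i) + (1 - c) * (1 / v'.μ₀ i))⁻¹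

namespace MultiAgentSystem

variable {S : MultiAgentSystem N n p m}

theorem Feasible.posVars {Q : Matrix (Fin n) (Fin n) ℝ} {R : Matrix (Fin p) (Fin p) ℝ} {r β : ℝ}
    {v : LMIVars N n} (h : S.Feasible Q R r β v) : S.PosVars v :=
  ⟨h.ν_pos, h.μ_pos, h.ν₀_pos, h.μ₀_pos⟩

theorem PosVars.mix {v v' : LMIVars N n} (h : S.PosVars v) (h' : S.PosVars v') {c : ℝ}
    (hc : c ∈ Icc (0 : ℝ) 1) : S.PosVars (v.mix c v') := by
  have key : ∀ x y : ℝ, 0 < x → 0 < y → 0 < (c * (1 / x) + (1 - c) * (1 / y))⁻¹ := by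
    intro x y hx hy
    have h0 := hc.1
    have h1 := hc.2
    have hx' : 0 < 1 / x := by positivity
    have hy' : 0 < 1 / y := by positivity
    refine inv_pos.2 ?_
    rcases h0.eq_or_lt with rfl | h0
    · simpa using hy
    · nlinarith [mul_pos h0 hx', mul_nonneg (sub_nonneg.2 h1) hy'.le]
  exact ⟨fun i j hij => key _ _ (h.ν_pos i j hij) (h'.ν_pos i j hij),
    fun i j hij => key _ _ (h.μ_pos i j hij) (h'.μ_pos i j hij),
    fun i hi => key _ _ (h.ν₀_pos i hi) (h'.ν₀_pos i hi),
    fun i hi => key _ _ (h.μ₀_pos i hi) (h'.μ₀_pos i hi)⟩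

theorem couplingWeight_mix (S : MultiAgentSystem N n p m) (v v' : LMIVars N n) (c : ℝ)
    (i : Fin N) :
    S.couplingWeight (v.mix c v') i
      = c * S.couplingWeight v i + (1 - c) * S.couplingWeight v' i := by
  have hite : ∀ (P : Prop) [Decidable P] (x x' : ℝ),
      (if P then (c * x + (1 - c) * x') else 0)
        = c * (if P then x else 0) + (1 - c) * (if P then x' else 0) := by
    intro P _ x x'
    split_ifs <;> ring
  have h2 : ∀ x x' y y' : ℝ, c * x + (1 - c) * x' + (c * y + (1 - c) * y')
      = c * (x + y) + (1 - c) * (x' + y') := by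
    intros
    ring
  simp only [couplingWeight, LMIVars.mix, one_div (_⁻¹), inv_inv, h2, hite, Finset.sum_add_distrib,
    ← Finset.mul_sum]

theorem ReducedLMI.mix {Q : Matrix (Fin n) (Fin n) ℝ} {R : Matrix (Fin p) (Fin p) ℝ} {r : ℝ}
    {v v' : LMIVars N n} (h : S.ReducedLMI Q R r v) (h' : S.ReducedLMI Q R r v') {c : ℝ}
    (hc : c ∈ Icc (0 : ℝ) 1) : S.ReducedLMI Q R r (v.mix c v') := by
  intro i ξ e f g f₀ g₀
  have k := mul_le_mul_of_nonneg_left (h i ξ e f g f₀ g₀) hc.1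
  have k' := mul_le_mul_of_nonneg_left (h' i ξ e f g f₀ g₀) (sub_nonneg.2 hc.2)
  have hY : (v.mix c v').Y *ᵥ ξ = c • (v.Y *ᵥ ξ) + (1 - c) • (v'.Y *ᵥ ξ) := by
    simp only [LMIVars.mix, add_mulVec, smul_mulVec]
  have hcoef := S.crossForm_combo_coeff Q i (fun j => f j ^ 2 * (1 / v.ν i j))
    (fun j => f j ^ 2 * (1 / v'.ν i j)) (fun j => g j ^ 2 * (1 / v.μ j i))
    (fun j => g j ^ 2 * (1 / v'.μ j i)) (f₀ ^ 2 * (1 / v.ν₀ i)) (f₀ ^ 2 * (1 / v'.ν₀ i))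
    (g₀ ^ 2 * (1 / N * (1 / v.μ₀ i))) (g₀ ^ 2 * (1 / N * (1 / v'.μ₀ i)))
    (add_sub_cancel c 1) e e
  refine le_trans ?_ (le_of_eq (hcoef.symm.trans ?_))
  · rw [hY, crossForm_combo_left, couplingWeight_mix, mulVec_add, mulVec_smul, mulVec_smul,
      dotProduct_add, dotProduct_smul, dotProduct_smul, smul_eq_mul, smul_eq_mul]
    linarith
  · simp only [LMIVars.mix, one_div (_⁻¹), inv_inv]
    congr 1
    · funext j
      ring
    · funext j
      ring
    · ring
    · ring

/-- The Riccati inequality behind the LMIs, for `ξ = Y⁻¹ e`. The last term consists of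
`e' Q̄ e` and of the weighted squares of the interaction outputs of follower `i`. -/
theorem ReducedLMI.riccati {Q : Matrix (Fin n) (Fin n) ℝ} {R : Matrix (Fin p) (Fin p) ℝ} {r : ℝ}
    {v : LMIVars N n} (h : S.ReducedLMI Q R r v) (i : Fin N) (ξ : Fin n → ℝ) :
    2 * (ξ ⬝ᵥ S.A r *ᵥ (v.Y *ᵥ ξ)) - ξ ⬝ᵥ (S.B₁ * R⁻¹ * S.B₁ᵀ) *ᵥ ξ
      + S.couplingWeight v i * ((S.B₂ᵀ *ᵥ ξ) ⬝ᵥ (S.B₂ᵀ *ᵥ ξ))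
      + S.crossForm Q i (v.ν i) (fun j => v.μ j i) (v.ν₀ i) (N * v.μ₀ i)
          (v.Y *ᵥ ξ) (v.Y *ᵥ ξ) ≤ 0 := by
  -- These multipliers maximize the left-hand side minus the right-hand side.
  have k := h i ξ (v.Y *ᵥ ξ) (v.ν i) (fun j => v.μ j i) (v.ν₀ i) (N * v.μ₀ i)
  have hN : (N : ℝ) ≠ 0 := by
    have := i.pos
    positivity
  have hsq : ∀ x : ℝ, x ^ 2 * (1 / x) = x := by
    intro x
    rcases eq_or_ne x 0 with rfl | hx
    · simp
    · field_simp
  have hsq' : (N * v.μ₀ i) ^ 2 * (1 / N * (1 / v.μ₀ i)) = N * v.μ₀ i := by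
    rw [one_div_mul_one_div_rev, mul_comm (v.μ₀ i), hsq]
  simp only [hsq, hsq'] at k
  linarith

end MultiAgentSystem

/-! ### The scheduled matrix -/

namespace Design

variable {D : Design M N n}

theorem weight_mem (D : Design M N n) (s : Fin M) (r : ℝ) : D.weight s r ∈ Icc (0 : ℝ) 1 :=
  ⟨le_max_left _ _, max_le zero_le_one (min_le_left _ _)⟩

theorem schedY_of_le (h : D.Ordered) {r : ℝ} (hr : r ≤ D.point 0) :
    D.schedY r = (D.sol 0).Y := by
  unfold schedY
  rw [Finset.sum_eq_zero, add_zero]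
  intro s _
  have := (point_strictMono h).monotone (Fin.zero_le s.castSucc)
  rw [weight_of_le h (by linarith [(h s).1]), sub_self, zero_smul]

theorem schedY_of_ge (h : D.Ordered) {r : ℝ} (hr : D.point (Fin.last M) ≤ r) :
    D.schedY r = (D.sol (Fin.last M)).Y := by
  unfold schedY
  rw [← telescope (fun k => (D.sol k).Y) (Fin.last M)]
  congr 1
  refine Finset.sum_congr rfl fun s _ => ?_
  have := (point_strictMono h).monotone (Fin.le_last s.succ)
  rw [weight_of_ge h (by linarith [(h s).2.2]), if_pos (Fin.castSucc_lt_last s), sub_zero, one_smul]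

theorem exists_mem_Icc_point (D : Design M N n) {r : ℝ} (h0 : D.point 0 ≤ r)
    (h1 : r < D.point (Fin.last M)) :
    ∃ s : Fin M, r ∈ Icc (D.point s.castSucc) (D.point s.succ) := by
  by_contra hcon
  push Not at hcon
  have : ∀ s, D.point s ≤ r := by
    intro s
    induction s using Fin.induction with
    | zero => exact h0
    | succ s ih => exact le_of_not_ge fun h => hcon s ⟨ih, h⟩
  exact (this (Fin.last M)).not_gt h1

theorem posDef_schedY (h : D.Ordered) (hpos : ∀ s, (D.sol s).Y.PosDef) (r : ℝ) :
    (D.schedY r).PosDef := by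
  rcases le_total r (D.point 0) with h0 | h0
  · rw [schedY_of_le h h0]
    exact hpos _
  rcases le_or_gt (D.point (Fin.last M)) r with h1 | h1
  · rw [schedY_of_ge h h1]
    exact hpos _
  obtain ⟨s, hs⟩ := D.exists_mem_Icc_point h0 h1
  rw [schedY_eq h s hs]
  obtain ⟨hw0, hw1⟩ := D.weight_mem s r
  rcases hw0.eq_or_lt with hw | hw
  · rw [← hw]
    simpa using hpos s.succ
  · exact ((hpos _).smul hw).add_posSemidef ((hpos _).posSemidef.smul (sub_nonneg.2 hw1))

/-- At every parameter value of `[a, b]` the scheduled matrix belongs to a solution of the reduced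
LMIs: near `ρ_s` the solution at `ρ_s` can be used, and where two solutions are interpolated both of
them can be used. -/
theorem Admissible.exists_reducedLMI {S : MultiAgentSystem N n p m}
    {Q : Matrix (Fin n) (Fin n) ℝ} {R : Matrix (Fin p) (Fin p) ℝ} {a b : ℝ}
    (hD : D.Admissible S Q R a b) (hQ : (S.Qbar Q).PosSemidef) {r : ℝ} (hr : r ∈ Icc a b) :
    ∃ v : LMIVars N n, v.Y = D.schedY r ∧ S.PosVars v ∧ S.ReducedLMI Q R r v := by
  have h := hD.ordered
  have use : ∀ s, (D.β s ^ 2 • (1 : Matrix (Fin n) (Fin n) ℝ)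
      - (S.A r - S.A (D.point s))ᵀ * (S.A r - S.A (D.point s))).PosSemidef →
      S.ReducedLMI Q R r (D.sol s) :=
    fun s hs => (hD.feasible s).reducedLMI hQ (hD.β_pos s) hs
  rcases le_total r (D.point 0) with h0 | h0
  · exact ⟨D.sol 0, (schedY_of_le h h0).symm, (hD.feasible 0).posVars,
      use 0 (hD.first r ⟨hr.1, h0⟩)⟩
  rcases le_or_gt (D.point (Fin.last M)) r with h1 | h1
  · exact ⟨D.sol _, (schedY_of_ge h h1).symm, (hD.feasible _).posVars,
      use _ (hD.last r ⟨h1, hr.2⟩)⟩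
  obtain ⟨s, hs⟩ := D.exists_mem_Icc_point h0 h1
  have hY := schedY_eq h s hs
  have hleft : r < D.hi s → S.ReducedLMI Q R r (D.sol s.castSucc) :=
    fun hlt => use _ (hD.right s r ⟨hs.1, hlt⟩)
  have hright : D.lo s ≤ r → S.ReducedLMI Q R r (D.sol s.succ) := by
    intro hle
    rcases hs.2.eq_or_lt with heq | hlt
    · refine use _ ?_
      rw [← heq, sub_self, mul_zero, sub_zero]
      exact PosSemidef.one.smul (sq_nonneg _)
    · exact use _ (hD.left s r ⟨hle, hlt⟩)
  rcases le_or_gt (D.hi s) r with hhi | hhi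
  · rw [weight_of_ge h hhi, zero_smul, zero_add, sub_zero, one_smul] at hY
    exact ⟨_, hY.symm, (hD.feasible _).posVars, hright ((h s).2.1.le.trans hhi)⟩
  rcases lt_or_ge r (D.lo s) with hlo | hlo
  · rw [weight_of_le h hlo.le, sub_self, zero_smul, add_zero, one_smul] at hY
    exact ⟨_, hY.symm, (hD.feasible _).posVars, hleft hhi⟩
  · exact ⟨_, hY.symm, (hD.feasible _).posVars.mix (hD.feasible _).posVars (D.weight_mem s r),
      (hleft hhi).mix (hright hlo) (D.weight_mem s r)⟩

end Design

/-! ### Dissipation along the closed-loop vector field -/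

/-- The tracking error of follower `i`. -/
def err (x : Fin (N + 1) → Fin n → ℝ) (i : Fin N) : Fin n → ℝ := x 0 - x i.succ

namespace MultiAgentSystem

variable (S : MultiAgentSystem N n p m)

open Classical in
/-- The protocol only uses the tracking errors, combined with the pinned Laplacian. -/
theorem sum_relative_states (x : Fin (N + 1) → Fin n → ℝ) (i : Fin N) :
    (∑ j : Fin N, if S.comm.Adj j.succ i.succ then x j.succ - x i.succ else 0)
      + pin S.comm i • (x 0 - x i.succ) = ∑ j, pinnedLaplacian S.comm i j • err x j := by
  have h1 : ∀ j, (if S.comm.Adj j.succ i.succ then x j.succ - x i.succ else 0)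
      = adjacency S.comm i j • err x i - adjacency S.comm i j • err x j := by
    intro j
    by_cases h : S.comm.Adj j.succ i.succ
    · have : adjacency S.comm i j = 1 := if_pos h
      rw [if_pos h, this, one_smul, one_smul]
      simp only [err]
      abel
    · have : adjacency S.comm i j = 0 := if_neg h
      rw [if_neg h, this, zero_smul, zero_smul, sub_zero]
  have h2 : ∀ j, pinnedLaplacian S.comm i j • err x j
      = (if i = j then (∑ k, adjacency S.comm i k) • err x i + pin S.comm i • err x i else 0)
        - adjacency S.comm i j • err x j := by
    intro j
    simp only [pinnedLaplacian, laplacian, Matrix.add_apply, Matrix.sub_apply, diagonal_apply]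
    split_ifs with h
    · subst h
      module
    · module
  rw [Finset.sum_congr rfl fun j _ => h1 j, Finset.sum_congr rfl fun j _ => h2 j,
    Finset.sum_sub_distrib, Finset.sum_sub_distrib, Finset.sum_ite_eq, if_pos (Finset.mem_univ i),
    ← Finset.sum_smul]
  simp only [err]
  abel

/-- The controls in terms of the vectors `X e_j`, where `X = Y_ρ⁻¹`. -/
theorem control_gain (D : Design M N n) (R : Matrix (Fin p) (Fin p) ℝ)
    (hpd : (symTheta S.comm).PosDef) (r : ℝ) (x : Fin (N + 1) → Fin n → ℝ) (i : Fin N) :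
    S.control (D.gain S R) r x i = (sigma S.comm)⁻¹ • ((R⁻¹ * S.B₁ᵀ) *ᵥ
      ∑ j, ((Theta S.comm)⁻¹ * pinnedLaplacian S.comm) i j • ((D.schedY r)⁻¹ *ᵥ err x j)) := by
  unfold control
  rw [sum_relative_states, Design.gain, neg_mulVec, neg_neg, smul_mulVec, ← mulVec_mulVec,
    mulVec_sum, Theta_inv hpd]
  simp only [diagonal_mul, mul_smul, mulVec_smul, ← Finset.smul_sum]
  rw [smul_smul, _root_.mul_inv_rev]

theorem posSemidef_inputGram {R : Matrix (Fin p) (Fin p) ℝ} (hR : R.PosDef) :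
    (S.B₁ * R⁻¹ * S.B₁ᵀ).PosSemidef := by
  have := hR.inv.posSemidef.mul_mul_conjTranspose_same S.B₁
  rwa [conjTranspose_eq_transpose_of_trivial] at this

/-- The control term in the derivative of the Lyapunov function. The gains contain `σ⁻¹`, which
cancels the lower bound `σ` of the quadratic form of `Θ⁻¹ (L + G)`. -/
theorem le_sum_input_power (D : Design M N n) {R : Matrix (Fin p) (Fin p) ℝ} (hR : R.PosDef)
    [Nonempty (Fin N)] (hpd : (symTheta S.comm).PosDef) (r : ℝ) (x : Fin (N + 1) → Fin n → ℝ) :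
    ∑ i, ((D.schedY r)⁻¹ *ᵥ err x i) ⬝ᵥ
        (S.B₁ * R⁻¹ * S.B₁ᵀ) *ᵥ ((D.schedY r)⁻¹ *ᵥ err x i)
      ≤ ∑ i, ((D.schedY r)⁻¹ *ᵥ err x i) ⬝ᵥ S.B₁ *ᵥ S.control (D.gain S R) r x i := by
  have hσ := sigma_pos hpd
  set y : Fin N → Fin n → ℝ := fun i => (D.schedY r)⁻¹ *ᵥ err x i
  have h := le_sum_sum_mul_of_posSemidef (sigma_mul_le hpd) (S.posSemidef_inputGram hR) y
  have h2 : ∀ i, y i ⬝ᵥ S.B₁ *ᵥ S.control (D.gain S R) r x i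
      = (sigma S.comm)⁻¹ * ∑ j, ((Theta S.comm)⁻¹ * pinnedLaplacian S.comm) i j
        * (y i ⬝ᵥ (S.B₁ * R⁻¹ * S.B₁ᵀ) *ᵥ y j) := by
    intro i
    rw [S.control_gain D R hpd, mulVec_smul, dotProduct_smul, smul_eq_mul, mulVec_mulVec,
      ← Matrix.mul_assoc, mulVec_sum, dotProduct_sum]
    simp only [mulVec_smul, dotProduct_smul, smul_eq_mul, y]
  rw [Finset.sum_congr rfl fun i _ => h2 i, ← Finset.mul_sum, inv_mul_eq_div, le_div_iff₀ hσ,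
    mul_comm]
  exact h

theorem sum_control_cost_le (D : Design M N n) {R : Matrix (Fin p) (Fin p) ℝ} (hR : R.PosDef)
    (hpd : (symTheta S.comm).PosDef) (r : ℝ) (x : Fin (N + 1) → Fin n → ℝ) :
    ∑ i, S.control (D.gain S R) r x i ⬝ᵥ R *ᵥ S.control (D.gain S R) r x i
      ≤ lambdaHat S.comm / sigma S.comm ^ 2 * ∑ i, ((D.schedY r)⁻¹ *ᵥ err x i) ⬝ᵥ
        (S.B₁ * R⁻¹ * S.B₁ᵀ) *ᵥ ((D.schedY r)⁻¹ *ᵥ err x i) := by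
  set y : Fin N → Fin n → ℝ := fun i => (D.schedY r)⁻¹ *ᵥ err x i
  set T := (Theta S.comm)⁻¹ * pinnedLaplacian S.comm
  have h := sum_sum_mul_le_of_posSemidef (dotProduct_gramTheta_le S.comm)
    (S.posSemidef_inputGram hR) y
  have hRR : R * (R⁻¹ * S.B₁ᵀ) = S.B₁ᵀ := by
    rw [← Matrix.mul_assoc, mul_nonsing_inv _ ((isUnit_iff_isUnit_det _).1 hR.isUnit),
      Matrix.one_mul]
  have h2 : ∀ i, S.control (D.gain S R) r x i ⬝ᵥ R *ᵥ S.control (D.gain S R) r x i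
      = (sigma S.comm ^ 2)⁻¹ * ∑ j, ∑ k, T i j * T i k
        * (y j ⬝ᵥ (S.B₁ * R⁻¹ * S.B₁ᵀ) *ᵥ y k) := by
    intro i
    set w := ∑ j, T i j • y j with hw
    have hc : S.control (D.gain S R) r x i = (sigma S.comm)⁻¹ • ((R⁻¹ * S.B₁ᵀ) *ᵥ w) :=
      S.control_gain D R hpd r x i
    rw [hc, mulVec_smul, dotProduct_smul, smul_dotProduct, smul_eq_mul, smul_eq_mul,
      mulVec_mulVec, hRR, dotProduct_comm, ← dotProduct_mulVec_comm S.B₁, mulVec_mulVec,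
      ← Matrix.mul_assoc, hw, sum_dotProduct, mulVec_sum, ← mul_assoc, ← _root_.mul_inv_rev, ← sq]
    congr 1
    refine Finset.sum_congr rfl fun j _ => ?_
    rw [dotProduct_sum]
    refine Finset.sum_congr rfl fun k _ => ?_
    rw [mulVec_smul, dotProduct_smul, smul_dotProduct, smul_eq_mul, smul_eq_mul]
    ring
  have hg : ∀ j k, gramTheta S.comm j k = ∑ i, T i j * T i k := by
    intro j k
    rw [gramTheta_eq, mul_apply]
    rfl
  rw [Finset.sum_congr rfl fun i _ => h2 i, ← Finset.mul_sum, div_eq_inv_mul, mul_assoc]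
  refine mul_le_mul_of_nonneg_left (le_trans (le_of_eq ?_) h) (by positivity)
  rw [Finset.sum_comm]
  refine Finset.sum_congr rfl fun j _ => ?_
  rw [Finset.sum_comm]
  refine Finset.sum_congr rfl fun k _ => ?_
  rw [hg, Finset.sum_mul]

/-- Young's inequality for an interaction channel with `Δ' Δ ≤ I`. -/
theorem two_mul_dotProduct_uncertain_le {c : ℕ} {Δ : Matrix (Fin m) (Fin c) ℝ}
    (hΔ : (1 - Δᵀ * Δ).PosSemidef) {a : ℝ} (ha : 0 < a) (z : Fin m → ℝ) (w : Fin c → ℝ) :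
    2 * (z ⬝ᵥ Δ *ᵥ w) ≤ 1 / a * (z ⬝ᵥ z) + a * (w ⬝ᵥ w) := by
  have h := nonneg_dotProduct_mulVec hΔ w
  rw [sub_mulVec, dotProduct_sub, one_mulVec, ← mulVec_mulVec, dotProduct_mulVec_comm _ᵀ,
    transpose_transpose] at h
  have := two_mul_dotProduct_le ha z (Δ *ᵥ w)
  nlinarith

open Classical in
/-- The interaction signal entering the dynamics of agent `i`. -/
def interaction (Δ : S.Uncertainty) (t : ℝ) (x : Fin (N + 1) → Fin n → ℝ) (i : Fin (N + 1)) :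
    Fin m → ℝ :=
  ∑ j, if S.coupling.Adj j i then Δ i j t *ᵥ (S.C i j *ᵥ (x j - x i)) else 0

open Classical in
/-- Influence of the followers on the leader, which enters the error dynamics of every follower. -/
theorem interaction_leader_le {Δ : S.Uncertainty} (hΔ : S.NormBounded Δ) {t : ℝ} (ht : 0 ≤ t)
    {v : LMIVars N n} (hv : S.PosVars v) (x : Fin (N + 1) → Fin n → ℝ) (z : Fin m → ℝ) :
    2 * (z ⬝ᵥ S.interaction Δ t x 0)
      ≤ (∑ k : Fin N, if S.coupling.Adj k.succ 0 then 1 / v.μ₀ k else 0) * (z ⬝ᵥ z)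
        + ∑ k : Fin N, if S.coupling.Adj k.succ 0 then
            v.μ₀ k * ((S.C 0 k.succ *ᵥ err x k) ⬝ᵥ (S.C 0 k.succ *ᵥ err x k)) else 0 := by
  rw [interaction, Fin.sum_univ_succ, if_neg (S.coupling_loopless 0), zero_add, dotProduct_sum,
    Finset.mul_sum, Finset.sum_mul, ← Finset.sum_add_distrib]
  refine Finset.sum_le_sum fun k _ => ?_
  split_ifs with h
  · have := two_mul_dotProduct_uncertain_le (hΔ _ _ h t ht) (hv.μ₀_pos k h) z
      (S.C 0 k.succ *ᵥ (x k.succ - x 0))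
    have hneg : x k.succ - x 0 = -err x k := by simp [err]
    rw [hneg, mulVec_neg, neg_dotProduct_neg] at this
    rw [hneg, mulVec_neg]
    exact this
  · simp

open Classical in
/-- Influence of the leader and of the other followers on follower `i`. For a channel from `j`, the
relative state is `e_i - e_j`; its two parts get the separate weights `ν i j` and `μ i j`. -/
theorem interaction_follower_le {Δ : S.Uncertainty} (hΔ : S.NormBounded Δ) {t : ℝ} (ht : 0 ≤ t)
    {v : LMIVars N n} (hv : S.PosVars v) (x : Fin (N + 1) → Fin n → ℝ) (i : Fin N)
    (z : Fin m → ℝ) :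
    2 * (z ⬝ᵥ -S.interaction Δ t x i.succ)
      ≤ ((∑ j : Fin N, if S.coupling.Adj j.succ i.succ then 1 / v.ν i j + 1 / v.μ i j else 0)
          + (if S.coupling.Adj 0 i.succ then 1 / v.ν₀ i else 0)) * (z ⬝ᵥ z)
        + (∑ j : Fin N, if S.coupling.Adj j.succ i.succ then
            v.ν i j * ((S.C i.succ j.succ *ᵥ err x i) ⬝ᵥ (S.C i.succ j.succ *ᵥ err x i)) else 0)
        + (∑ j : Fin N, if S.coupling.Adj j.succ i.succ then
            v.μ i j * ((S.C i.succ j.succ *ᵥ err x j) ⬝ᵥ (S.C i.succ j.succ *ᵥ err x j)) else 0)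
        + (if S.coupling.Adj 0 i.succ then
            v.ν₀ i * ((S.C i.succ 0 *ᵥ err x i) ⬝ᵥ (S.C i.succ 0 *ᵥ err x i)) else 0) := by
  rw [interaction, Fin.sum_univ_succ, neg_add, dotProduct_add, mul_add, ← Finset.sum_neg_distrib,
    dotProduct_sum, Finset.mul_sum, add_mul, Finset.sum_mul]
  have h0 : 2 * (z ⬝ᵥ -(if S.coupling.Adj 0 i.succ then
        Δ i.succ 0 t *ᵥ (S.C i.succ 0 *ᵥ (x 0 - x i.succ)) else 0))
      ≤ (if S.coupling.Adj 0 i.succ then 1 / v.ν₀ i else 0) * (z ⬝ᵥ z)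
        + (if S.coupling.Adj 0 i.succ then
            v.ν₀ i * ((S.C i.succ 0 *ᵥ err x i) ⬝ᵥ (S.C i.succ 0 *ᵥ err x i)) else 0) := by
    split_ifs with h
    · have := two_mul_dotProduct_uncertain_le (hΔ _ _ h t ht) (hv.ν₀_pos i h) z
        (-(S.C i.succ 0 *ᵥ err x i))
      rw [neg_dotProduct_neg, mulVec_neg] at this
      exact this
    · simp
  have h1 : ∀ j ∈ Finset.univ, 2 * (z ⬝ᵥ -(if S.coupling.Adj (Fin.succ j) i.succ then
        Δ i.succ j.succ t *ᵥ (S.C i.succ j.succ *ᵥ (x j.succ - x i.succ)) else 0))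
      ≤ (if S.coupling.Adj j.succ i.succ then 1 / v.ν i j + 1 / v.μ i j else 0) * (z ⬝ᵥ z)
        + (if S.coupling.Adj j.succ i.succ then
            v.ν i j * ((S.C i.succ j.succ *ᵥ err x i) ⬝ᵥ (S.C i.succ j.succ *ᵥ err x i)) else 0)
        + (if S.coupling.Adj j.succ i.succ then
            v.μ i j * ((S.C i.succ j.succ *ᵥ err x j) ⬝ᵥ (S.C i.succ j.succ *ᵥ err x j))
            else 0) := by
    intro j _
    split_ifs with h
    · have k1 := two_mul_dotProduct_uncertain_le (hΔ _ _ h t ht) (hv.ν_pos i j h) z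
        (-(S.C i.succ j.succ *ᵥ err x i))
      have k2 := two_mul_dotProduct_uncertain_le (hΔ _ _ h t ht) (hv.μ_pos i j h) z
        (S.C i.succ j.succ *ᵥ err x j)
      have hsub : -(Δ i.succ j.succ t *ᵥ (S.C i.succ j.succ *ᵥ (x j.succ - x i.succ)))
          = Δ i.succ j.succ t *ᵥ (-(S.C i.succ j.succ *ᵥ err x i))
            + Δ i.succ j.succ t *ᵥ (S.C i.succ j.succ *ᵥ err x j) := by
        rw [← mulVec_neg, ← mulVec_neg, ← mulVec_neg, ← mulVec_add, ← mulVec_add]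
        congr 2
        simp only [err]
        abel
      rw [neg_dotProduct_neg] at k1
      rw [hsub, dotProduct_add]
      linarith
    · simp
  have h2 := Finset.sum_le_sum h1
  rw [Finset.sum_add_distrib, Finset.sum_add_distrib] at h2
  linarith

/-- Dissipation inequality: along the closed-loop vector field the quadratic form `∑ e_i' X e_i`
with frozen `X = Y_ρ⁻¹` decreases at least at the rate
`∑ e_i' (X B₁ R⁻¹ B₁' X + Q̄) e_i`. -/
theorem dissipation (D : Design M N n) {Q : Matrix (Fin n) (Fin n) ℝ}
    {R : Matrix (Fin p) (Fin p) ℝ} (hR : R.PosDef) [Nonempty (Fin N)]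
    (hpd : (symTheta S.comm).PosDef) {ρ : ℝ → ℝ} {t : ℝ} (ht : 0 ≤ t) {v : LMIVars N n}
    (hvY : v.Y = D.schedY (ρ t)) (hY : (D.schedY (ρ t)).PosDef) (hv : S.PosVars v)
    (hred : S.ReducedLMI Q R (ρ t) v) {Δ : S.Uncertainty} (hΔ : S.NormBounded Δ)
    (x : Fin (N + 1) → Fin n → ℝ) :
    ∑ i, 2 * (((D.schedY (ρ t))⁻¹ *ᵥ err x i) ⬝ᵥ
        err (S.closedLoopField (D.gain S R) ρ Δ t x) i)
      ≤ -∑ i, (((D.schedY (ρ t))⁻¹ *ᵥ err x i) ⬝ᵥ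
          (S.B₁ * R⁻¹ * S.B₁ᵀ) *ᵥ ((D.schedY (ρ t))⁻¹ *ᵥ err x i)
        + err x i ⬝ᵥ S.Qbar Q *ᵥ err x i) := by
  classical
  set X := (D.schedY (ρ t))⁻¹ with hX
  have hYX : ∀ e, v.Y *ᵥ (X *ᵥ e) = e := by
    intro e
    rw [hvY, mulVec_mulVec, mul_nonsing_inv _ ((isUnit_iff_isUnit_det _).1 hY.isUnit), one_mulVec]
  have hin := S.le_sum_input_power D hR hpd (ρ t) x
  rw [← hX] at hin
  have hfield : ∀ i : Fin N, err (S.closedLoopField (D.gain S R) ρ Δ t x) i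
      = S.A (ρ t) *ᵥ err x i - S.B₁ *ᵥ S.control (D.gain S R) (ρ t) x i
        + S.B₂ *ᵥ S.interaction Δ t x 0 + S.B₂ *ᵥ -S.interaction Δ t x i.succ := by
    intro i
    simp only [err, closedLoopField, allControls, Fin.cons_zero, Fin.cons_succ, mulVec_zero,
      mulVec_sub, mulVec_neg, interaction]
    abel
  have hpt : ∀ i : Fin N, 2 * ((X *ᵥ err x i) ⬝ᵥ
        err (S.closedLoopField (D.gain S R) ρ Δ t x) i)
      ≤ (X *ᵥ err x i) ⬝ᵥ (S.B₁ * R⁻¹ * S.B₁ᵀ) *ᵥ (X *ᵥ err x i)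
        - 2 * ((X *ᵥ err x i) ⬝ᵥ S.B₁ *ᵥ S.control (D.gain S R) (ρ t) x i)
        - err x i ⬝ᵥ S.Qbar Q *ᵥ err x i
        + ((∑ k : Fin N, if S.coupling.Adj k.succ 0 then
              v.μ₀ k * ((S.C 0 k.succ *ᵥ err x k) ⬝ᵥ (S.C 0 k.succ *ᵥ err x k)) else 0)
          - (if S.coupling.Adj i.succ 0 then
              N * v.μ₀ i * ((S.C 0 i.succ *ᵥ err x i) ⬝ᵥ (S.C 0 i.succ *ᵥ err x i)) else 0))
        + ((∑ j : Fin N, if S.coupling.Adj j.succ i.succ then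
              v.μ i j * ((S.C i.succ j.succ *ᵥ err x j) ⬝ᵥ (S.C i.succ j.succ *ᵥ err x j)) else 0)
          - ∑ j : Fin N, if S.coupling.Adj i.succ j.succ then
              v.μ j i * ((S.C j.succ i.succ *ᵥ err x i) ⬝ᵥ (S.C j.succ i.succ *ᵥ err x i))
              else 0) := by
    intro i
    have h1 := S.interaction_leader_le hΔ ht hv x (S.B₂ᵀ *ᵥ (X *ᵥ err x i))
    have h2 := S.interaction_follower_le hΔ ht hv x i (S.B₂ᵀ *ᵥ (X *ᵥ err x i))
    have h3 := hred.riccati i (X *ᵥ err x i)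
    rw [hYX, crossForm, couplingWeight] at h3
    rw [← dotProduct_mulVec_comm] at h1 h2
    rw [hfield i, dotProduct_add, dotProduct_add, dotProduct_sub]
    linarith
  -- Summed over the followers, the output terms of the interactions are those of the Riccati
  -- inequalities: the leader's channels occur once for every follower, hence the factor `N`.
  have hleader : ∑ i : Fin N, ((∑ k : Fin N, if S.coupling.Adj k.succ 0 then
        v.μ₀ k * ((S.C 0 k.succ *ᵥ err x k) ⬝ᵥ (S.C 0 k.succ *ᵥ err x k)) else 0)
      - (if S.coupling.Adj i.succ 0 then
          N * v.μ₀ i * ((S.C 0 i.succ *ᵥ err x i) ⬝ᵥ (S.C 0 i.succ *ᵥ err x i)) else 0)) = 0 := by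
    rw [Finset.sum_sub_distrib, Finset.sum_const, Finset.card_univ, Fintype.card_fin,
      nsmul_eq_mul, Finset.mul_sum, sub_eq_zero]
    refine Finset.sum_congr rfl fun i _ => ?_
    split_ifs
    · ring
    · simp
  have hfollow : ∑ i : Fin N, ((∑ j : Fin N, if S.coupling.Adj j.succ i.succ then
        v.μ i j * ((S.C i.succ j.succ *ᵥ err x j) ⬝ᵥ (S.C i.succ j.succ *ᵥ err x j)) else 0)
      - ∑ j : Fin N, if S.coupling.Adj i.succ j.succ then
          v.μ j i * ((S.C j.succ i.succ *ᵥ err x i) ⬝ᵥ (S.C j.succ i.succ *ᵥ err x i))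
          else 0) = 0 := by
    rw [Finset.sum_sub_distrib, sub_eq_zero, Finset.sum_comm]
  refine (Finset.sum_le_sum fun i _ => hpt i).trans ?_
  rw [Finset.sum_add_distrib, Finset.sum_add_distrib, hleader, hfollow, Finset.sum_sub_distrib,
    Finset.sum_sub_distrib, Finset.sum_add_distrib, ← Finset.mul_sum]
  linarith

/-- The running cost is bounded by the dissipation rate. -/
theorem running_cost_le (D : Design M N n) {Q : Matrix (Fin n) (Fin n) ℝ}
    {R : Matrix (Fin p) (Fin p) ℝ} (hR : R.PosDef) [Nonempty (Fin N)]
    (hpd : (symTheta S.comm).PosDef) (r : ℝ) (x : Fin (N + 1) → Fin n → ℝ) :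
    ∑ i, (err x i ⬝ᵥ Q *ᵥ err x i
        + S.control (D.gain S R) r x i ⬝ᵥ R *ᵥ S.control (D.gain S R) r x i)
      ≤ lambdaHat S.comm / sigma S.comm ^ 2 * ∑ i, (((D.schedY r)⁻¹ *ᵥ err x i) ⬝ᵥ
          (S.B₁ * R⁻¹ * S.B₁ᵀ) *ᵥ ((D.schedY r)⁻¹ *ᵥ err x i)
        + err x i ⬝ᵥ S.Qbar Q *ᵥ err x i) := by
  have hσ := sigma_pos hpd
  have hl := lambdaHat_pos hpd
  have h := S.sum_control_cost_le D hR hpd r x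
  have hQ : ∀ e : Fin n → ℝ, e ⬝ᵥ Q *ᵥ e
      = lambdaHat S.comm / sigma S.comm ^ 2 * (e ⬝ᵥ S.Qbar Q *ᵥ e) := by
    intro e
    rw [Qbar, smul_mulVec, dotProduct_smul, smul_eq_mul]
    field_simp
  rw [Finset.sum_add_distrib, Finset.sum_add_distrib, mul_add,
    Finset.sum_congr rfl fun i _ => hQ (err x i), ← Finset.mul_sum]
  linarith

end MultiAgentSystem

/-! ### Regularity of the scheduled matrix -/

open Filter Topology NNReal in
/-- Mean value inequality for a Lipschitz function whose derivative is bounded almost everywhere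
where it exists. -/
theorem norm_sub_le_of_ae_norm_deriv_le {E : Type*} [NormedAddCommGroup E] [NormedSpace ℝ E]
    [FiniteDimensional ℝ E] {g : ℝ → E} {K : ℝ≥0} {c d : ℝ} (hcd : c ≤ d)
    (hg : LipschitzOnWith K g (Icc c d)) {B : ℝ} (hB : 0 ≤ B)
    (h : ∀ᵐ r, r ∈ Ioo c d → ‖deriv g r‖ ≤ B) : ‖g d - g c‖ ≤ B * (d - c) := by
  have hdiff : ∀ᵐ r, r ∈ Ioo c d → DifferentiableAt ℝ g r := by
    filter_upwards [hg.ae_differentiableWithinAt_of_mem_real] with r hr hmem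
    exact (hr (Ioo_subset_Icc_self hmem)).differentiableAt (Icc_mem_nhds hmem.1 hmem.2)
  refine NormedSpace.norm_le_dual_bound ℝ _ (mul_nonneg hB (sub_nonneg.2 hcd)) fun l => ?_
  have hφ : AbsolutelyContinuousOnInterval (fun r => l (g r)) c d :=
    LipschitzOnWith.absolutelyContinuousOnInterval (K := ‖l‖₊ * K) <| by
      rw [uIcc_of_le hcd]
      exact l.lipschitz.comp_lipschitzOnWith hg
  rw [map_sub, ← hφ.integral_deriv_eq_sub]
  have hne : ∀ᵐ r : ℝ, r ≠ d := by
    have := measure_singleton (μ := (volume : Measure ℝ)) d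
    rw [ae_iff]
    simp
  calc ‖∫ r in c..d, deriv (fun r => l (g r)) r‖ ≤ (‖l‖ * B) * |d - c| := by
        refine intervalIntegral.norm_integral_le_of_norm_le_const_ae ?_
        filter_upwards [h, hdiff, hne] with r h1 h2 h3 hr
        rw [uIoc_of_le hcd] at hr
        have hmem : r ∈ Ioo c d := ⟨hr.1, hr.2.lt_of_ne h3⟩
        have : HasDerivAt (fun r => l (g r)) (l (deriv g r)) r :=
          l.hasFDerivAt.comp_hasDerivAt r (h2 hmem).hasDerivAt
        rw [this.deriv]
        exact (l.le_opNorm _).trans (by gcongr; exact h1 hmem)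
    _ = B * (d - c) * ‖l‖ := by
        rw [abs_of_nonneg (sub_nonneg.2 hcd)]
        ring

open scoped Matrix.Norms.L2Operator in
/-- The spectral norm bounds the quadratic form. -/
theorem abs_dotProduct_mulVec_le (X : Matrix (Fin n) (Fin n) ℝ) (v : Fin n → ℝ) :
    |v ⬝ᵥ X *ᵥ v| ≤ ‖X‖ * (v ⬝ᵥ v) := by
  set V : EuclideanSpace ℝ (Fin n) := WithLp.toLp 2 v
  set W : EuclideanSpace ℝ (Fin n) := WithLp.toLp 2 (X *ᵥ v)
  have h1 : ‖W‖ ≤ ‖X‖ * ‖V‖ := X.l2_opNorm_mulVec V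
  have h2 : v ⬝ᵥ X *ᵥ v = inner ℝ W V := by
    rw [EuclideanSpace.inner_eq_star_dotProduct]
    simp [V, W]
  have h3 : v ⬝ᵥ v = ‖V‖ ^ 2 := by
    rw [← real_inner_self_eq_norm_sq, EuclideanSpace.inner_eq_star_dotProduct]
    simp [V]
  rw [h2, h3]
  calc |inner ℝ W V| ≤ ‖W‖ * ‖V‖ := abs_real_inner_le_norm _ _
    _ ≤ ‖X‖ * ‖V‖ * ‖V‖ := by gcongr
    _ = ‖X‖ * ‖V‖ ^ 2 := by ring

namespace Design

variable {D : Design M N n}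

theorem abs_weight_sub_le (D : Design M N n) (s : Fin M) (r r' : ℝ) :
    |D.weight s r - D.weight s r'| ≤ |D.hi s - D.lo s|⁻¹ * |r - r'| := by
  unfold weight
  set f := (D.hi s - r) / (D.hi s - D.lo s)
  set f' := (D.hi s - r') / (D.hi s - D.lo s)
  have h1 : |max 0 (min 1 f) - max 0 (min 1 f')| ≤ |min 1 f - min 1 f'| := by
    refine (abs_max_sub_max_le_max 0 _ 0 _).trans ?_
    simp
  have h2 : |min 1 f - min 1 f'| ≤ |f - f'| := by
    refine (abs_min_sub_min_le_max 1 _ 1 _).trans ?_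
    simp
  refine (h1.trans h2).trans (le_of_eq ?_)
  rw [← sub_div, abs_div, div_eq_inv_mul, show D.hi s - r - (D.hi s - r') = -(r - r') by ring,
    abs_neg]

open scoped Matrix.Norms.L2Operator in
theorem exists_norm_schedY_sub_le (D : Design M N n) :
    ∃ L, 0 ≤ L ∧ ∀ r r', ‖D.schedY r - D.schedY r'‖ ≤ L * |r - r'| := by
  refine ⟨∑ s : Fin M, |D.hi s - D.lo s|⁻¹ * ‖(D.sol s.succ).Y - (D.sol s.castSucc).Y‖,
    Finset.sum_nonneg fun s _ => by positivity, fun r r' => ?_⟩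
  have : D.schedY r - D.schedY r' = ∑ s : Fin M,
      (D.weight s r' - D.weight s r) • ((D.sol s.succ).Y - (D.sol s.castSucc).Y) := by
    unfold schedY
    rw [add_sub_add_left_eq_sub, ← Finset.sum_sub_distrib]
    refine Finset.sum_congr rfl fun s _ => ?_
    module
  rw [this, Finset.sum_mul]
  refine (norm_sum_le _ _).trans (Finset.sum_le_sum fun s _ => ?_)
  rw [norm_smul, Real.norm_eq_abs, mul_right_comm, abs_sub_comm r r']
  gcongr
  exact D.abs_weight_sub_le s r' r

theorem continuous_schedY (D : Design M N n) : Continuous D.schedY := by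
  unfold schedY weight
  fun_prop

theorem continuous_schedY_inv (h : D.Ordered) (hpos : ∀ s, (D.sol s).Y.PosDef) :
    Continuous fun r => (D.schedY r)⁻¹ := by
  have hdet : ∀ r, (D.schedY r).det ≠ 0 := fun r => (posDef_schedY h hpos r).det_pos.ne'
  have : (fun r => (D.schedY r)⁻¹) = fun r => (D.schedY r).det⁻¹ • (D.schedY r).adjugate := by
    funext r
    rw [inv_def, Ring.inverse_eq_inv']
  rw [this]
  exact (D.continuous_schedY.matrix_det.inv₀ hdet).smul D.continuous_schedY.matrix_adjugate

open scoped Matrix.Norms.L2Operator NNReal in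
theorem exists_lipschitzOnWith_schedY_inv (h : D.Ordered) (hpos : ∀ s, (D.sol s).Y.PosDef)
    (c d : ℝ) : ∃ K : ℝ≥0, LipschitzOnWith K (fun r => (D.schedY r)⁻¹) (Icc c d) := by
  obtain ⟨L, hL, hLip⟩ := D.exists_norm_schedY_sub_le
  obtain ⟨C, hC⟩ := isCompact_Icc.exists_bound_of_continuousOn
    (s := Icc c d) (continuous_schedY_inv h hpos).continuousOn
  have hu : ∀ r, IsUnit (D.schedY r).det := fun r =>
    (isUnit_iff_isUnit_det _).1 (posDef_schedY h hpos r).isUnit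
  refine ⟨(C ^ 2 * L).toNNReal, LipschitzOnWith.of_dist_le_mul fun r hr r' hr' => ?_⟩
  have hC0 : 0 ≤ C := (norm_nonneg _).trans (hC r hr)
  have heq : (D.schedY r)⁻¹ - (D.schedY r')⁻¹
      = (D.schedY r)⁻¹ * (D.schedY r' - D.schedY r) * (D.schedY r')⁻¹ := by
    rw [Matrix.mul_sub, Matrix.sub_mul, nonsing_inv_mul _ (hu r), Matrix.mul_assoc,
      mul_nonsing_inv _ (hu r'), Matrix.mul_one, Matrix.one_mul]
  rw [dist_eq_norm, heq, Real.coe_toNNReal _ (by positivity), Real.dist_eq]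
  calc ‖(D.schedY r)⁻¹ * (D.schedY r' - D.schedY r) * (D.schedY r')⁻¹‖
      ≤ ‖(D.schedY r)⁻¹‖ * ‖D.schedY r' - D.schedY r‖ * ‖(D.schedY r')⁻¹‖ :=
        (norm_mul_le _ _).trans (by gcongr; exact norm_mul_le _ _)
    _ ≤ C * (L * |r' - r|) * C := by
        gcongr
        · exact hC r hr
        · exact hLip r' r
        · exact hC r' hr'
    _ = C ^ 2 * L * |r - r'| := by
        rw [abs_sub_comm]
        ring

open scoped Matrix.Norms.L2Operator in
theorem norm_deriv_le_varrho (h : D.Ordered) (hpos : ∀ s, (D.sol s).Y.PosDef) {a b r : ℝ}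
    (hr : r ∈ Icc a b) (hr' : r ∉ D.corners) :
    ‖deriv (fun r' => (D.schedY r')⁻¹) r‖ ≤ D.varrho a b := by
  refine le_csSup ?_ ⟨r, ⟨hr, hr'⟩, rfl⟩
  -- A margin around `[a, b]` is needed, since the derivative at an end point is two-sided.
  obtain ⟨K, hK⟩ := exists_lipschitzOnWith_schedY_inv h hpos (a - 1) (b + 1)
  refine ⟨K, ?_⟩
  rintro _ ⟨s, ⟨hs, -⟩, rfl⟩
  exact norm_deriv_le_of_lipschitzOn (Icc_mem_nhds (by linarith [hs.1]) (by linarith [hs.2])) hK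

open scoped Matrix.Norms.L2Operator in
theorem varrho_nonneg (D : Design M N n) (a b : ℝ) : 0 ≤ D.varrho a b := by
  refine Real.sSup_nonneg ?_
  rintro _ ⟨r, -, rfl⟩
  exact norm_nonneg (deriv (fun r' => (D.schedY r')⁻¹) r)

open scoped Matrix.Norms.L2Operator in
/-- `ϱ` is a Lipschitz constant of `Y_ρ⁻¹` on `[a, b]`: there are finitely many corners. -/
theorem norm_schedY_inv_sub_le (h : D.Ordered) (hpos : ∀ s, (D.sol s).Y.PosDef) {a b r r' : ℝ}
    (hr : r ∈ Icc a b) (hr' : r' ∈ Icc a b) :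
    ‖(D.schedY r)⁻¹ - (D.schedY r')⁻¹‖ ≤ D.varrho a b * |r - r'| := by
  wlog hle : r' ≤ r generalizing r r'
  · rw [norm_sub_rev, abs_sub_comm]
    exact this hr' hr (le_of_not_ge hle)
  obtain ⟨K, hK⟩ := exists_lipschitzOnWith_schedY_inv h hpos r' r
  have hc : ∀ᵐ s : ℝ, s ∉ D.corners :=
    measure_eq_zero_iff_ae_notMem.1
      (((finite_range D.lo).union (finite_range D.hi)).measure_zero volume)
  rw [abs_of_nonneg (sub_nonneg.2 hle)]
  refine norm_sub_le_of_ae_norm_deriv_le hle hK (D.varrho_nonneg a b) ?_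
  filter_upwards [hc] with s hs hmem
  exact norm_deriv_le_varrho h hpos ⟨hr'.1.trans hmem.1.le, hmem.2.le.trans hr.2⟩ hs

open scoped Matrix.Norms.L2Operator in
/-- Along the parameter trajectory `Y_ρ⁻¹` is Lipschitz in time with constant `η q`, by the rate
condition. -/
theorem norm_schedY_inv_comp_sub_le (h : D.Ordered) (hpos : ∀ s, (D.sol s).Y.PosDef) {a b c : ℝ}
    {ρ : ℝ → ℝ} (hmem : ∀ t ∈ Ici (0 : ℝ), ρ t ∈ Icc a b) (hdiff : DifferentiableOn ℝ ρ (Ici 0))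
    (hrate : ∀ t ∈ Ici (0 : ℝ), D.varrho a b * |derivWithin ρ (Ici 0) t| ≤ c)
    {s t : ℝ} (hs : s ∈ Ici (0 : ℝ)) (ht : t ∈ Ici (0 : ℝ)) :
    ‖(D.schedY (ρ s))⁻¹ - (D.schedY (ρ t))⁻¹‖ ≤ c * |s - t| := by
  refine (norm_schedY_inv_sub_le h hpos (hmem s hs) (hmem t ht)).trans ?_
  have h0 := D.varrho_nonneg a b
  have key := Convex.norm_image_sub_le_of_norm_derivWithin_le (C := c)
    (hdiff.const_mul (D.varrho a b)) (fun u hu => ?_) (convex_Ici 0) ht hs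
  · rw [← mul_sub, norm_mul, Real.norm_eq_abs, Real.norm_eq_abs, Real.norm_eq_abs,
      abs_of_nonneg h0] at key
    exact key
  · rw [derivWithin_const_mul _ (hdiff u hu), norm_mul, Real.norm_eq_abs, Real.norm_eq_abs,
      abs_of_nonneg h0]
    exact hrate u hu

/-- `η` bounds the dissipation rate from below. -/
theorem eta_mul_le (D : Design M N n) (h : D.Ordered) (hpos : ∀ s, (D.sol s).Y.PosDef)
    (S : MultiAgentSystem N n p m) {Q : Matrix (Fin n) (Fin n) ℝ} {R : Matrix (Fin p) (Fin p) ℝ}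
    (hR : R.PosDef) (hQ : (S.Qbar Q).PosSemidef) {a b r : ℝ} (hr : r ∈ Icc a b)
    (e : Fin n → ℝ) :
    D.eta S Q R a b * (e ⬝ᵥ e) ≤ ((D.schedY r)⁻¹ *ᵥ e) ⬝ᵥ
        (S.B₁ * R⁻¹ * S.B₁ᵀ) *ᵥ ((D.schedY r)⁻¹ *ᵥ e) + e ⬝ᵥ S.Qbar Q *ᵥ e := by
  have hps : ∀ r, ((D.schedY r)⁻¹ * S.B₁ * R⁻¹ * S.B₁ᵀ * (D.schedY r)⁻¹
      + S.Qbar Q).PosSemidef := by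
    intro r
    have h1 := (S.posSemidef_inputGram hR).mul_mul_conjTranspose_same (D.schedY r)⁻¹
    rw [show (D.schedY r)⁻¹ᴴ = (D.schedY r)⁻¹ from (posDef_schedY h hpos r).inv.1] at h1
    have h2 := h1.add hQ
    simpa only [Matrix.mul_assoc] using h2
  have h1 := lambdaMin_mul_le (hps r).1 e
  have h2 : D.eta S Q R a b ≤ lambdaMin ((D.schedY r)⁻¹ * S.B₁ * R⁻¹ * S.B₁ᵀ * (D.schedY r)⁻¹
      + S.Qbar Q) := by
    refine csInf_le ⟨0, ?_⟩ ⟨r, hr, rfl⟩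
    rintro _ ⟨s, -, rfl⟩
    exact lambdaMin_nonneg (hps s)
  have hXt : (D.schedY r)⁻¹ᵀ = (D.schedY r)⁻¹ := by
    rw [← conjTranspose_eq_transpose_of_trivial]
    exact (posDef_schedY h hpos r).inv.1
  have h3 : e ⬝ᵥ ((D.schedY r)⁻¹ * S.B₁ * R⁻¹ * S.B₁ᵀ * (D.schedY r)⁻¹ + S.Qbar Q) *ᵥ e
      = ((D.schedY r)⁻¹ *ᵥ e) ⬝ᵥ (S.B₁ * R⁻¹ * S.B₁ᵀ) *ᵥ ((D.schedY r)⁻¹ *ᵥ e)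
        + e ⬝ᵥ S.Qbar Q *ᵥ e := by
    rw [add_mulVec, dotProduct_add, Matrix.mul_assoc, Matrix.mul_assoc, Matrix.mul_assoc,
      ← mulVec_mulVec, dotProduct_mulVec_comm _ e, hXt]
    simp only [← mulVec_mulVec]
  rw [h3] at h1
  exact (mul_le_mul_of_nonneg_right h2 (dotProduct_self_nonneg' e)).trans h1

/-- The gains depend continuously on the parameter. -/
theorem continuous_gain (h : D.Ordered) (hpos : ∀ s, (D.sol s).Y.PosDef)
    (S : MultiAgentSystem N n p m) (R : Matrix (Fin p) (Fin p) ℝ) (i : Fin N) :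
    Continuous (D.gain S R i) := by
  have := continuous_schedY_inv h hpos
  unfold gain
  fun_prop

end Design

/-! ### Absolute continuity and integration in time -/

open Filter Topology in
theorem absolutelyContinuousOnInterval_apply {ι : Type*} [Fintype ι] {f : ℝ → ι → ℝ} {a b : ℝ}
    (hf : AbsolutelyContinuousOnInterval f a b) (i : ι) :
    AbsolutelyContinuousOnInterval (fun t => f t i) a b :=
  squeeze_zero (fun _ => Finset.sum_nonneg fun _ _ => dist_nonneg)
    (fun _ => Finset.sum_le_sum fun _ _ => dist_le_pi_dist _ _ i) hf

theorem absolutelyContinuousOnInterval_sum {ι : Type*} (s : Finset ι) {f : ι → ℝ → ℝ} {a b : ℝ}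
    (hf : ∀ i ∈ s, AbsolutelyContinuousOnInterval (f i) a b) :
    AbsolutelyContinuousOnInterval (fun t => ∑ i ∈ s, f i t) a b := by
  classical
  induction s using Finset.induction_on with
  | empty =>
    simp only [Finset.sum_empty]
    exact ((LipschitzWith.const (0 : ℝ)).lipschitzOnWith).absolutelyContinuousOnInterval
  | insert i s hi ih =>
    simp only [Finset.sum_insert hi]
    exact (hf i (Finset.mem_insert_self i s)).add
      (ih fun j hj => hf j (Finset.mem_insert_of_mem hj))

open Filter Topology in
/-- Comparison of derivatives for functions that touch at `t`, up to a term of first order. -/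
theorem deriv_le_add_of_le_add_mul {V U h : ℝ → ℝ} {V' U' t : ℝ} (hV : HasDerivAt V V' t)
    (hU : HasDerivAt U U' t) (hh : ContinuousAt h t) (heq : V t = U t)
    (hle : ∀ s, t < s → V s ≤ U s + (s - t) * h s) : V' ≤ U' + h t := by
  have h1 : Tendsto (slope V t) (𝓝[>] t) (𝓝 V') :=
    (hasDerivAt_iff_tendsto_slope.1 hV).mono_left (nhdsWithin_mono _ fun s hs => ne_of_gt hs)
  have h2 : Tendsto (slope U t) (𝓝[>] t) (𝓝 U') :=
    (hasDerivAt_iff_tendsto_slope.1 hU).mono_left (nhdsWithin_mono _ fun s hs => ne_of_gt hs)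
  refine le_of_tendsto_of_tendsto h1 (h2.add (hh.tendsto.mono_left nhdsWithin_le_nhds)) ?_
  filter_upwards [self_mem_nhdsWithin] with s hs
  have hst : 0 < s - t := sub_pos.2 hs
  have h3 := hle s hs
  rw [slope_def_field, slope_def_field, div_add' _ _ _ hst.ne', div_le_div_iff_of_pos_right hst]
  linarith

open Filter Topology in
theorem lintegral_Ioi_le_of_forall_intervalIntegral_le {F : ℝ → ℝ} {B : ℝ}
    (hF : ContinuousOn F (Ici 0)) (h0 : ∀ t, 0 ≤ t → 0 ≤ F t)
    (hB : ∀ T, 0 ≤ T → ∫ t in (0 : ℝ)..T, F t ≤ B) :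
    ∫⁻ t in Ioi (0 : ℝ), ENNReal.ofReal (F t) ≤ ENNReal.ofReal B := by
  have hint : ∀ T : ℝ, 0 ≤ T → IntervalIntegrable F volume 0 T := fun T hT =>
    (hF.mono (by rw [uIcc_of_le hT]; exact Icc_subset_Ici_self)).intervalIntegrable
  have hon : IntegrableOn F (Ioi 0) := by
    refine integrableOn_Ioi_of_intervalIntegral_norm_bounded (l := atTop) (b := id) B 0
      (fun T => ?_) tendsto_id ?_
    · rcases le_total 0 T with hT | hT
      · exact (intervalIntegrable_iff_integrableOn_Ioc_of_le hT).1 (hint T hT)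
      · simp [Ioc_eq_empty (not_lt.2 hT)]
    · filter_upwards [eventually_ge_atTop 0] with T hT
      refine le_trans (le_of_eq ?_) (hB T hT)
      refine intervalIntegral.integral_congr fun t ht => ?_
      rw [id, uIcc_of_le hT] at ht
      exact Real.norm_of_nonneg (h0 t ht.1)
  rw [← ofReal_integral_eq_lintegral_ofReal hon
    ((ae_restrict_iff' measurableSet_Ioi).2 (ae_of_all _ fun t ht => h0 t (le_of_lt ht)))]
  refine ENNReal.ofReal_le_ofReal ?_
  refine le_of_tendsto (intervalIntegral_tendsto_integral_Ioi 0 hon tendsto_id) ?_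
  filter_upwards [eventually_ge_atTop 0] with T hT
  exact hB T hT

/-- A nonnegative rate `F` that is dominated by the decay of an absolutely continuous nonnegative
function `V`. -/
theorem lintegral_le_of_deriv_le {F V : ℝ → ℝ} {κ : ℝ} (hκ : 0 ≤ κ)
    (hF : ContinuousOn F (Ici 0)) (h0 : ∀ t, 0 ≤ t → 0 ≤ F t)
    (hV : ∀ T, 0 ≤ T → AbsolutelyContinuousOnInterval V 0 T) (hV0 : ∀ t, 0 ≤ t → 0 ≤ V t)
    (hdecay : ∀ᵐ t, 0 < t → DifferentiableAt ℝ V t → F t ≤ -κ * deriv V t) :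
    ∫⁻ t in Ioi (0 : ℝ), ENNReal.ofReal (F t) ≤ ENNReal.ofReal (κ * V 0) := by
  refine lintegral_Ioi_le_of_forall_intervalIntegral_le hF h0 fun T hT => ?_
  have hint : IntervalIntegrable F volume 0 T :=
    (hF.mono (by rw [uIcc_of_le hT]; exact Icc_subset_Ici_self)).intervalIntegrable
  calc ∫ t in (0 : ℝ)..T, F t ≤ ∫ t in (0 : ℝ)..T, -κ * deriv V t := by
        refine intervalIntegral.integral_mono_ae_restrict hT hint
          ((hV T hT).intervalIntegrable_deriv.const_mul _) ?_
        have hne : ∀ᵐ t : ℝ, t ≠ 0 := by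
          rw [ae_iff]
          simp
        refine (ae_restrict_iff' measurableSet_Icc).2 ?_
        filter_upwards [hdecay, (hV T hT).ae_differentiableAt, hne] with t h1 h2 h3 ht
        exact h1 (ht.1.lt_of_ne' h3) (h2 (by rwa [uIcc_of_le hT]))
    _ = -κ * (V T - V 0) := by
        rw [intervalIntegral.integral_const_mul, (hV T hT).integral_deriv_eq_sub]
    _ ≤ κ * V 0 := by nlinarith [mul_nonneg hκ (hV0 T hT)]

/-! ### The Lyapunov function along trajectories -/

/-- The Lyapunov function `∑ e_i' Y_ρ⁻¹ e_i`. -/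
def lyapunov (D : Design M N n) (ρ : ℝ → ℝ) (x : ℝ → Fin (N + 1) → Fin n → ℝ) (t : ℝ) : ℝ :=
  ∑ i, err (x t) i ⬝ᵥ (D.schedY (ρ t))⁻¹ *ᵥ err (x t) i

namespace MultiAgentSystem

variable {S : MultiAgentSystem N n p m} {D : Design M N n}
  {K : Fin N → ℝ → Matrix (Fin p) (Fin n) ℝ} {ρ : ℝ → ℝ} {Δ : S.Uncertainty}
  {x₀ : Fin (N + 1) → Fin n → ℝ} {x : ℝ → Fin (N + 1) → Fin n → ℝ}

theorem IsTrajectory.continuousOn (hx : S.IsTrajectory K ρ Δ x₀ x) (i : Fin (N + 1)) :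
    ContinuousOn (fun t => x t i) (Ici 0) := by
  intro t ht
  have h1 := (hx.absCont i (t + 1) (by linarith [mem_Ici.1 ht])).continuousOn
  rw [uIcc_of_le (by linarith [mem_Ici.1 ht])] at h1
  have hmem : Icc 0 (t + 1) ∈ nhdsWithin t (Ici 0) := by
    rw [← Ici_inter_Iic]
    exact Filter.inter_mem self_mem_nhdsWithin
      (mem_nhdsWithin_of_mem_nhds (Iic_mem_nhds (by linarith)))
  exact (h1 t ⟨ht, by linarith⟩).mono_of_mem_nhdsWithin hmem

open scoped Matrix.Norms.L2Operator NNReal in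
theorem IsTrajectory.absolutelyContinuous_lyapunov (hx : S.IsTrajectory K ρ Δ x₀ x) {c : ℝ}
    (hc : ∀ s ∈ Ici (0 : ℝ), ∀ t ∈ Ici (0 : ℝ),
      ‖(D.schedY (ρ s))⁻¹ - (D.schedY (ρ t))⁻¹‖ ≤ c * |s - t|) {T : ℝ} (hT : 0 ≤ T) :
    AbsolutelyContinuousOnInterval (lyapunov D ρ x) 0 T := by
  have he : ∀ i k, AbsolutelyContinuousOnInterval (fun t => err (x t) i k) 0 T := fun i k =>
    (absolutelyContinuousOnInterval_apply (hx.absCont 0 T hT) k).sub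
      (absolutelyContinuousOnInterval_apply (hx.absCont i.succ T hT) k)
  have hX : ∀ k l, AbsolutelyContinuousOnInterval (fun t => (D.schedY (ρ t))⁻¹ k l) 0 T := by
    intro k l
    have hLip : LipschitzOnWith c.toNNReal (fun t => (D.schedY (ρ t))⁻¹) (uIcc 0 T) := by
      rw [uIcc_of_le hT]
      refine LipschitzOnWith.of_dist_le_mul fun s hs t ht => ?_
      rw [dist_eq_norm, Real.dist_eq]
      refine (hc s hs.1 t ht.1).trans ?_
      gcongr
      exact Real.le_coe_toNNReal c
    let entry : Matrix (Fin n) (Fin n) ℝ →L[ℝ] ℝ :=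
      LinearMap.toContinuousLinearMap (Matrix.entryLinearMap ℝ ℝ k l)
    exact (entry.lipschitz.comp_lipschitzOnWith hLip).absolutelyContinuousOnInterval
  unfold lyapunov
  simp only [dotProduct, mulVec]
  exact absolutelyContinuousOnInterval_sum _ fun i _ =>
    absolutelyContinuousOnInterval_sum _ fun k _ => (he i k).mul <|
      absolutelyContinuousOnInterval_sum _ fun l _ => (hX k l).mul (he i l)

open scoped Matrix.Norms.L2Operator in
/-- At almost every time the Lyapunov function decreases at least as fast as the quadratic form
with frozen `Y_ρ⁻¹`, up to `c ∑ |e_i|²`. Neither `Y_ρ⁻¹` nor its composition with `ρ` has to be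
differentiable. -/
theorem deriv_lyapunov_le (hY : ∀ t, ((D.schedY (ρ t))⁻¹)ᵀ = (D.schedY (ρ t))⁻¹) {c t : ℝ}
    (ht : 0 < t)
    (hc : ∀ s ∈ Ici (0 : ℝ), ∀ t ∈ Ici (0 : ℝ),
      ‖(D.schedY (ρ s))⁻¹ - (D.schedY (ρ t))⁻¹‖ ≤ c * |s - t|)
    {F : Fin (N + 1) → Fin n → ℝ} (hx : ∀ i, HasDerivAt (fun s => x s i) (F i) t)
    (hV : DifferentiableAt ℝ (lyapunov D ρ x) t) :
    deriv (lyapunov D ρ x) t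
      ≤ ∑ i, 2 * (((D.schedY (ρ t))⁻¹ *ᵥ err (x t) i) ⬝ᵥ err F i)
        + c * ∑ i, err (x t) i ⬝ᵥ err (x t) i := by
  set X := (D.schedY (ρ t))⁻¹ with hX
  have he : ∀ i, HasDerivAt (fun s => err (x s) i) (err F i) t := fun i =>
    (hx 0).sub (hx i.succ)
  have hek : ∀ i k, HasDerivAt (fun s => err (x s) i k) (err F i k) t := fun i k =>
    hasDerivAt_pi.1 (he i) k
  have hU : HasDerivAt (fun s => ∑ i, err (x s) i ⬝ᵥ X *ᵥ err (x s) i)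
      (∑ i, 2 * ((X *ᵥ err (x t) i) ⬝ᵥ err F i)) t := by
    refine HasDerivAt.fun_sum fun i _ => ?_
    have h1 : HasDerivAt (fun s => err (x s) i ⬝ᵥ X *ᵥ err (x s) i)
        (err F i ⬝ᵥ X *ᵥ err (x t) i + err (x t) i ⬝ᵥ X *ᵥ err F i) t := by
      simp only [dotProduct, mulVec]
      rw [← Finset.sum_add_distrib]
      exact HasDerivAt.fun_sum fun k _ => (hek i k).mul <|
        HasDerivAt.fun_sum fun l _ => (hek i l).const_mul (X k l)
    have h2 : 2 * ((X *ᵥ err (x t) i) ⬝ᵥ err F i)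
        = err F i ⬝ᵥ X *ᵥ err (x t) i + err (x t) i ⬝ᵥ X *ᵥ err F i := by
      rw [dotProduct_mulVec_comm X (err (x t) i), hY, dotProduct_comm (err F i)]
      ring
    rw [h2]
    exact h1
  have hcont : ContinuousAt (fun s => c * ∑ i, err (x s) i ⬝ᵥ err (x s) i) t := by
    have hc1 : ∀ i k, ContinuousAt (fun s => err (x s) i k) t := fun i k => (hek i k).continuousAt
    simp only [dotProduct]
    fun_prop
  refine deriv_le_add_of_le_add_mul (h := fun s => c * ∑ i, err (x s) i ⬝ᵥ err (x s) i)
    hV.hasDerivAt hU hcont rfl fun s hs => ?_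
  have h1 : lyapunov D ρ x s = ∑ i, err (x s) i ⬝ᵥ X *ᵥ err (x s) i
      + ∑ i, err (x s) i ⬝ᵥ ((D.schedY (ρ s))⁻¹ - X) *ᵥ err (x s) i := by
    rw [← Finset.sum_add_distrib]
    refine Finset.sum_congr rfl fun i _ => ?_
    rw [sub_mulVec, dotProduct_sub]
    ring
  rw [h1, ← mul_assoc, Finset.mul_sum]
  refine add_le_add_right (Finset.sum_le_sum fun i _ => ?_) _
  refine (le_abs_self _).trans ((abs_dotProduct_mulVec_le _ _).trans ?_)
  refine mul_le_mul_of_nonneg_right ?_ (dotProduct_self_nonneg' _)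
  have := hc s (ht.trans hs).le t ht.le
  rwa [abs_of_pos (sub_pos.2 hs), mul_comm] at this

theorem IsTrajectory.continuousOn_cost (hx : S.IsTrajectory K ρ Δ x₀ x)
    (Q : Matrix (Fin n) (Fin n) ℝ) (R : Matrix (Fin p) (Fin p) ℝ) (i : Fin N)
    (hK : ContinuousOn (fun t => K i (ρ t)) (Ici 0)) :
    ContinuousOn (fun t => err (x t) i ⬝ᵥ Q *ᵥ err (x t) i
      + S.control K (ρ t) (x t) i ⬝ᵥ R *ᵥ S.control K (ρ t) (x t) i) (Ici 0) := by
  have he : ∀ j, ContinuousOn (fun t => err (x t) j) (Ici 0) := fun j =>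
    (hx.continuousOn 0).sub (hx.continuousOn j.succ)
  have hw : ContinuousOn (fun t => ∑ j, pinnedLaplacian S.comm i j • err (x t) j) (Ici 0) :=
    continuousOn_finsetSum _ fun j _ => (continuous_const_smul _).comp_continuousOn (he j)
  have hu : ContinuousOn (fun t => S.control K (ρ t) (x t) i) (Ici 0) := by
    unfold control
    simp only [sum_relative_states]
    exact ((continuous_fst.matrix_mulVec continuous_snd).comp_continuousOn (hK.prodMk hw)).neg
  have hquad : ∀ {k : ℕ} (A : Matrix (Fin k) (Fin k) ℝ), Continuous fun v => v ⬝ᵥ A *ᵥ v :=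
    fun A => continuous_id.dotProduct (continuous_const.matrix_mulVec continuous_id)
  exact ((hquad Q).comp_continuousOn (he i)).add ((hquad R).comp_continuousOn hu)

end MultiAgentSystem

/-! ### The performance bound -/

namespace MultiAgentSystem

variable {S : MultiAgentSystem N n p m} {D : Design M N n} {Q : Matrix (Fin n) (Fin n) ℝ}
  {R : Matrix (Fin p) (Fin p) ℝ} {a b q : ℝ} {ρ : ℝ → ℝ}

theorem posSemidef_Qbar [Nonempty (Fin N)] (hQ : Q.PosDef) (hpd : (symTheta S.comm).PosDef) :
    (S.Qbar Q).PosSemidef :=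
  hQ.posSemidef.smul (div_nonneg (sq_nonneg _) (lambdaHat_pos hpd).le)

open scoped Matrix.Norms.L2Operator in
/-- Along every closed-loop trajectory the running cost is at most
`λ̂ / ((1 - q) σ²)` times the rate of decrease of the Lyapunov function. -/
theorem running_cost_le_deriv [Nonempty (Fin N)] (hQ : Q.PosDef) (hR : R.PosDef)
    (hpd : (symTheta S.comm).PosDef) (hD : D.Admissible S Q R a b) (hq : q ∈ Ico (0 : ℝ) 1)
    (hρ : ∀ t ∈ Ici (0 : ℝ), ρ t ∈ Icc a b)
    (hLip : ∀ s ∈ Ici (0 : ℝ), ∀ t ∈ Ici (0 : ℝ),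
      ‖(D.schedY (ρ s))⁻¹ - (D.schedY (ρ t))⁻¹‖ ≤ D.eta S Q R a b * q * |s - t|)
    {Δ : S.Uncertainty} (hΔ : S.NormBounded Δ) {x : ℝ → Fin (N + 1) → Fin n → ℝ} {t : ℝ}
    (ht : 0 < t)
    (hx : ∀ i, HasDerivAt (fun s => x s i) (S.closedLoopField (D.gain S R) ρ Δ t (x t) i) t)
    (hV : DifferentiableAt ℝ (lyapunov D ρ x) t) :
    ∑ i, (err (x t) i ⬝ᵥ Q *ᵥ err (x t) i
        + S.control (D.gain S R) (ρ t) (x t) i ⬝ᵥ R *ᵥ S.control (D.gain S R) (ρ t) (x t) i)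
      ≤ -(lambdaHat S.comm / ((1 - q) * sigma S.comm ^ 2)) * deriv (lyapunov D ρ x) t := by
  have hpos : ∀ s, (D.sol s).Y.PosDef := fun s => (hD.feasible s).Y_pos
  have hYpos := Design.posDef_schedY hD.ordered hpos
  have hYt : ∀ t, ((D.schedY (ρ t))⁻¹)ᵀ = (D.schedY (ρ t))⁻¹ := fun t => by
    rw [← conjTranspose_eq_transpose_of_trivial]
    exact (hYpos (ρ t)).inv.1
  have hQb := posSemidef_Qbar (S := S) hQ hpd
  have hσ := sigma_pos hpd
  have hl := lambdaHat_pos hpd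
  have hq1 : 0 < 1 - q := sub_pos.2 hq.2
  obtain ⟨v, hvY, hv, hred⟩ := hD.exists_reducedLMI hQb (hρ t ht.le)
  have h1 := deriv_lyapunov_le hYt ht hLip hx hV
  have h2 := S.dissipation D hR hpd ht.le hvY (hYpos _) hv hred hΔ (x t)
  have h3 := S.running_cost_le D (Q := Q) hR hpd (ρ t) (x t)
  set W := ∑ i, (((D.schedY (ρ t))⁻¹ *ᵥ err (x t) i) ⬝ᵥ
      (S.B₁ * R⁻¹ * S.B₁ᵀ) *ᵥ ((D.schedY (ρ t))⁻¹ *ᵥ err (x t) i)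
    + err (x t) i ⬝ᵥ S.Qbar Q *ᵥ err (x t) i)
  have h4 : D.eta S Q R a b * ∑ i, err (x t) i ⬝ᵥ err (x t) i ≤ W := by
    rw [Finset.mul_sum]
    exact Finset.sum_le_sum fun i _ =>
      D.eta_mul_le hD.ordered hpos S hR hQb (hρ t ht.le) (err (x t) i)
  -- The variation of `Y_ρ⁻¹` consumes at most the fraction `q` of the dissipation.
  have h5 := mul_le_mul_of_nonneg_left h4 hq.1
  have h6 : deriv (lyapunov D ρ x) t ≤ -((1 - q) * W) := by linarith
  refine h3.trans ?_
  calc lambdaHat S.comm / sigma S.comm ^ 2 * W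
      = lambdaHat S.comm / ((1 - q) * sigma S.comm ^ 2) * ((1 - q) * W) := by field_simp
    _ ≤ lambdaHat S.comm / ((1 - q) * sigma S.comm ^ 2) * (-deriv (lyapunov D ρ x) t) := by
        gcongr
        linarith
    _ = _ := by ring

theorem IsTrajectory.cost_le [Nonempty (Fin N)] (hQ : Q.PosDef) (hR : R.PosDef)
    (hpd : (symTheta S.comm).PosDef) (hD : D.Admissible S Q R a b) (hq : q ∈ Ico (0 : ℝ) 1)
    (hρ : ∀ t ∈ Ici (0 : ℝ), ρ t ∈ Icc a b) (hdiff : DifferentiableOn ℝ ρ (Ici 0))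
    (hrate : ∀ t ∈ Ici (0 : ℝ),
      D.varrho a b * |derivWithin ρ (Ici 0) t| ≤ D.eta S Q R a b * q)
    {Δ : S.Uncertainty} (hΔ : S.NormBounded Δ) {x₀ : Fin (N + 1) → Fin n → ℝ}
    {x : ℝ → Fin (N + 1) → Fin n → ℝ} (hx : S.IsTrajectory (D.gain S R) ρ Δ x₀ x) :
    S.cost Q R (D.gain S R) ρ x ≤ ENNReal.ofReal
      (lambdaHat S.comm / ((1 - q) * sigma S.comm ^ 2) *
        ∑ i : Fin N, (x₀ 0 - x₀ i.succ) ⬝ᵥ (D.schedY (ρ 0))⁻¹ *ᵥ (x₀ 0 - x₀ i.succ)) := by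
  have hpos : ∀ s, (D.sol s).Y.PosDef := fun s => (hD.feasible s).Y_pos
  have hYpos := Design.posDef_schedY hD.ordered hpos
  have hLip := fun s hs t ht =>
    Design.norm_schedY_inv_comp_sub_le (D := D) hD.ordered hpos hρ hdiff hrate (s := s) (t := t)
      hs ht
  set f : Fin N → ℝ → ℝ := fun i t => err (x t) i ⬝ᵥ Q *ᵥ err (x t) i
    + S.control (D.gain S R) (ρ t) (x t) i ⬝ᵥ R *ᵥ S.control (D.gain S R) (ρ t) (x t) i
  have hf0 : ∀ i t, 0 ≤ f i t := fun i t => add_nonneg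
    (nonneg_dotProduct_mulVec hQ.posSemidef _) (nonneg_dotProduct_mulVec hR.posSemidef _)
  have hfc : ∀ i, ContinuousOn (f i) (Ici 0) := fun i =>
    hx.continuousOn_cost Q R i
      ((Design.continuous_gain hD.ordered hpos S R i).comp_continuousOn hdiff.continuousOn)
  have hcost : S.cost Q R (D.gain S R) ρ x
      = ∫⁻ t in Ioi (0 : ℝ), ENNReal.ofReal (∑ i, f i t) := by
    rw [lintegral_congr fun t => ENNReal.ofReal_sum_of_nonneg fun i _ => hf0 i t,
      lintegral_finsetSum']
    · rfl
    · exact fun i _ => ENNReal.measurable_ofReal.comp_aemeasurable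
        (((hfc i).mono Ioi_subset_Ici_self).aemeasurable measurableSet_Ioi)
  have hV0 : lyapunov D ρ x 0
      = ∑ i : Fin N, (x₀ 0 - x₀ i.succ) ⬝ᵥ (D.schedY (ρ 0))⁻¹ *ᵥ (x₀ 0 - x₀ i.succ) := by
    rw [lyapunov, hx.initial]
    rfl
  rw [hcost, ← hV0]
  refine lintegral_le_of_deriv_le
    (div_nonneg (lambdaHat_pos hpd).le (mul_nonneg (sub_nonneg.2 hq.2.le) (sq_nonneg _)))
    (continuousOn_finsetSum _ fun i _ => hfc i) (fun t _ => Finset.sum_nonneg fun i _ => hf0 i t)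
    (fun T hT => hx.absolutelyContinuous_lyapunov hLip hT)
    (fun t _ => Finset.sum_nonneg fun i _ =>
      nonneg_dotProduct_mulVec (hYpos (ρ t)).inv.posSemidef _) ?_
  filter_upwards [ae_all_iff.2 hx.dynamics] with t hdyn ht hV
  exact running_cost_le_deriv hQ hR hpd hD hq hρ hLip hΔ ht (fun i => hdyn i ht) hV

end MultiAgentSystem

end LeaderFollower

end

theorem theorem2 {N n p m M : ℕ} (S : LeaderFollower.MultiAgentSystem N n p m)
    (Q : Matrix (Fin n) (Fin n) ℝ) (R : Matrix (Fin p) (Fin p) ℝ)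
    (hQ : Q.PosDef) (hR : R.PosDef)
    (hgraph : LeaderFollower.HasPinnedSpanningTree S.comm)
    (hpd : (LeaderFollower.symTheta S.comm).PosDef)
    (a b : ℝ) (hA : ContinuousOn S.A (Set.Icc a b))
    (D : LeaderFollower.Design M N n) (hD : D.Admissible S Q R a b)
    (ρ : ℝ → ℝ) (hρ_mem : ∀ t ∈ Set.Ici (0 : ℝ), ρ t ∈ Set.Icc a b)
    (hρ_diff : DifferentiableOn ℝ ρ (Set.Ici 0))
    (q : ℝ) (hq : q ∈ Set.Ico (0 : ℝ) 1)
    (hrate : ∀ t ∈ Set.Ici (0 : ℝ),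
      D.varrho a b * |derivWithin ρ (Set.Ici 0) t| ≤ D.eta S Q R a b * q) :
    (∀ i, ContinuousOn (D.gain S R i) (Set.Icc a b)) ∧
    S.SolvesTracking Q R (D.gain S R) ρ ∧
    ∀ x₀ : Fin (N + 1) → Fin n → ℝ,
      S.worstCost Q R (D.gain S R) ρ x₀ ≤ ENNReal.ofReal
        (LeaderFollower.lambdaHat S.comm / ((1 - q) * LeaderFollower.sigma S.comm ^ 2) *
          ∑ i : Fin N, (x₀ 0 - x₀ i.succ) ⬝ᵥ
            (D.schedY (ρ 0))⁻¹ *ᵥ (x₀ 0 - x₀ i.succ)) := by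
  have : Nonempty (Fin N) := by
    obtain ⟨-, r, -⟩ := hgraph
    exact ⟨r⟩
  have hbound : ∀ x₀ : Fin (N + 1) → Fin n → ℝ,
      S.worstCost Q R (D.gain S R) ρ x₀ ≤ ENNReal.ofReal
        (LeaderFollower.lambdaHat S.comm / ((1 - q) * LeaderFollower.sigma S.comm ^ 2) *
          ∑ i : Fin N, (x₀ 0 - x₀ i.succ) ⬝ᵥ
            (D.schedY (ρ 0))⁻¹ *ᵥ (x₀ 0 - x₀ i.succ)) := fun x₀ =>
    iSup_le fun _ => iSup_le fun hΔ => iSup_le fun _ => iSup_le fun hx =>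
      hx.cost_le hQ hR hpd hD hq hρ_mem hρ_diff hrate hΔ
  refine ⟨fun i => (LeaderFollower.Design.continuous_gain hD.ordered
    (fun s => (hD.feasible s).Y_pos) S R i).continuousOn, fun x₀ => ?_, hbound⟩
  set B := LeaderFollower.lambdaHat S.comm / ((1 - q) * LeaderFollower.sigma S.comm ^ 2) *
    ∑ i : Fin N, (x₀ 0 - x₀ i.succ) ⬝ᵥ (D.schedY (ρ 0))⁻¹ *ᵥ (x₀ 0 - x₀ i.succ)
  refine ⟨|B| + 1, (hbound x₀).trans_lt ?_⟩
  exact (ENNReal.ofReal_lt_ofReal_iff (by positivity)).2 (by linarith [le_abs_self B])
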